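/- For a real-valued function $u\in L^2(\mathbb R)$ let $u'+u^2$ denote the distribution $\langle u'+u^2,f\rangle=\int u^2f\,dx-\int u f'\,dx$. Let $\mathcal Q$ be the set of all real distributions $q\in H^{-1}(\mathbb R)$ for which there are real-valued functions $u_+\in L^2(\mathbb R)\cap L^1(0,\infty)$ and $u_-\in L^2(\mathbb R)\cap L^1(-\infty,0)$ such that $q=u_+'+u_+^2=u_-'+u_-^2$. For a real distribution $q\in H^{-1}(\mathbb R)$, the Schrödinger operator $-\frac{d^2}{dx^2}+q$ is called nonnegative if $\int|\varphi'(x)|^2\,dx+\langle q,|\varphi|^2\rangle\ge 0$ for all (complex-valued) $\varphi\in C_0^\infty(\mathbb R)$. **Proposition 2.11.** Let $q_0\in\mathcal Q$. (i) If $q_1\in H^{-1}(\mathbb R)$ is a real distribution with compact support such that the Schrödinger operator $-\frac{d^2}{dx^2}+q_0+q_1$ is nonnegative, then $q_0+q_1\in\mathcal Q$. (ii) In particular, for all $n\ge 0$, points $x_1,\dots,x_n\in\mathbb R$ and numbers $\alpha_1,\dots,\alpha_n\ge 0$, one has $q_0+\sum_{j=1}^n\alpha_j\delta_{x_j}\in\mathcal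 Q$. (iii) In particular, let $n\ge 0$, $x_1,\dots,x_n\in\mathbb R$, $\alpha_j,\beta_j\ge 0$ and a real-valued $\phi\in C_0^\infty(\mathbb R)$ be given, put $u_j(x)=\phi(x-x_j)\log|x-x_j|$, which is a function in $L^2(\mathbb R)$, and $$q=q_0+\sum_{j=1}^n\alpha_j\delta_{x_j}+\sum_{j=1}^n\beta_j\,(u_j'+u_j^2).$$ If the Schrödinger operator $-\frac{d^2}{dx^2}+q$ is nonnegative, then $q\in\mathcal Q$. -/

import Mathlib

open MeasureTheory TemperedDistribution
open scoped SchwartzMap ContDiff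

noncomputable section

namespace Miura

/-! Distributions on the line are Mathlib's (complex-valued) tempered distributions `𝓢'(ℝ, ℂ)`,
`q ∈ H⁻¹(ℝ)` is `MemSobolev (-1) 2 q` and the support of `q` is `dsupport q`. -/

/-- A distribution is real (`q = q̄`) if it takes real values on real test functions. -/
def IsRealDist (q : 𝓢'(ℝ, ℂ)) : Prop :=
  ∀ f : 𝓢(ℝ, ℂ), (∀ x, (f x).im = 0) → (q f).im = 0

/-- `u ∈ L²(ℝ)` as a distribution. -/
def ofL2 (u : ℝ → ℝ) (hu : MemLp u 2 volume) : 𝓢'(ℝ, ℂ) :=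
  ((hu.ofReal (K := ℂ)).toLp : Lp ℂ 2 (volume : Measure ℝ))

/-- The square of a function of `L²(ℝ)` is a function of `L¹(ℝ)`. -/
theorem memLp_sq {u : ℝ → ℝ} (hu : MemLp u 2 volume) :
    MemLp (fun x => ((u x ^ 2 : ℝ) : ℂ)) 1 volume :=
  MemLp.ofReal (memLp_one_iff_integrable.2 hu.integrable_sq)

/-- `u² ∈ L¹(ℝ)` as a distribution. -/
def sqOfL2 (u : ℝ → ℝ) (hu : MemLp u 2 volume) : 𝓢'(ℝ, ℂ) :=
  ((memLp_sq hu).toLp : Lp ℂ 1 (volume : Measure ℝ))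

/-- The Miura map `u ↦ u' + u²` on real-valued `u ∈ L²(ℝ)`, with the distributional derivative. -/
def miura (u : ℝ → ℝ) (hu : MemLp u 2 volume) : 𝓢'(ℝ, ℂ) :=
  derivCLM ℂ (ofL2 u hu) + sqOfL2 u hu

/-- The pairing that defines the Miura map: `⟨u' + u², f⟩ = ∫ u² f - ∫ u f'`. -/
theorem miura_apply (u : ℝ → ℝ) (hu : MemLp u 2 volume) (f : 𝓢(ℝ, ℂ)) :
    miura u hu f = (∫ x, ((u x ^ 2 : ℝ) : ℂ) * f x) - ∫ x, (u x : ℂ) * deriv f x := by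
  have h1 : ofL2 u hu (-SchwartzMap.derivCLM ℂ ℂ f) = -∫ x, (u x : ℂ) * deriv f x := by
    rw [ofL2, Lp.toTemperedDistribution_apply, ← integral_neg]
    refine integral_congr_ae ?_
    filter_upwards [(hu.ofReal (K := ℂ)).coeFn_toLp] with x hx
    rw [hx]
    simp [mul_comm]
  have h2 : sqOfL2 u hu f = ∫ x, ((u x ^ 2 : ℝ) : ℂ) * f x := by
    rw [sqOfL2, Lp.toTemperedDistribution_apply]
    refine integral_congr_ae ?_
    filter_upwards [(memLp_sq hu).coeFn_toLp] with x hx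
    rw [hx]
    simp [mul_comm]
  change ofL2 u hu (-SchwartzMap.derivCLM ℂ ℂ f) + sqOfL2 u hu f = _
  rw [h1, h2]
  ring

/-- The class `𝒬`: real `q ∈ H⁻¹(ℝ)` with `q = u₊' + u₊² = u₋' + u₋²` for some real-valued
`u₊ ∈ L²(ℝ) ∩ L¹(0, ∞)` and `u₋ ∈ L²(ℝ) ∩ L¹(-∞, 0)`. -/
def classQ : Set 𝓢'(ℝ, ℂ) :=
  {q | IsRealDist q ∧ MemSobolev (-1) 2 q ∧
    (∃ (u : ℝ → ℝ) (hu : MemLp u 2 volume), IntegrableOn u (Set.Ioi 0) ∧ q = miura u hu) ∧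
    (∃ (u : ℝ → ℝ) (hu : MemLp u 2 volume), IntegrableOn u (Set.Iio 0) ∧ q = miura u hu)}

theorem hasCompactSupport_normSq {φ : ℝ → ℂ} (hc : HasCompactSupport φ) :
    HasCompactSupport (fun x => ((‖φ x‖ ^ 2 : ℝ) : ℂ)) :=
  hc.comp_left (g := fun z : ℂ => ((‖z‖ ^ 2 : ℝ) : ℂ)) (by simp)

theorem contDiff_normSq {φ : ℝ → ℂ} (hφ : ContDiff ℝ ∞ φ) :
    ContDiff ℝ ∞ (fun x => ((‖φ x‖ ^ 2 : ℝ) : ℂ)) :=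
  Complex.ofRealCLM.contDiff.comp (hφ.norm_sq ℝ)

/-- `|φ|²` as a test function, for `φ ∈ C₀^∞(ℝ)`. -/
def normSq (φ : ℝ → ℂ) (hφ : ContDiff ℝ ∞ φ) (hc : HasCompactSupport φ) : 𝓢(ℝ, ℂ) :=
  (hasCompactSupport_normSq hc).toSchwartzMap (contDiff_normSq hφ)

/-- The quadratic form `∫ |φ'|² + ⟨q, |φ|²⟩` of `-d²/dx² + q` (for real `q`) on `C₀^∞(ℝ)`. -/
def schrodingerForm (q : 𝓢'(ℝ, ℂ)) (φ : ℝ → ℂ) (hφ : ContDiff ℝ ∞ φ)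
    (hc : HasCompactSupport φ) : ℝ :=
  (∫ x, ‖deriv φ x‖ ^ 2) + (q (normSq φ hφ hc)).re

/-- The Schrödinger operator `-d²/dx² + q` is nonnegative: its quadratic form is nonnegative
on `C₀^∞(ℝ)`. -/
def SchrodingerNonneg (q : 𝓢'(ℝ, ℂ)) : Prop :=
  ∀ (φ : ℝ → ℂ) (hφ : ContDiff ℝ ∞ φ) (hc : HasCompactSupport φ), 0 ≤ schrodingerForm q φ hφ hc

/-- The truncated logarithm `x ↦ ϕ(x - a) log |x - a|` (`Real.log` is `log |·|`). -/
def cutLog (ϕ : ℝ → ℝ) (a : ℝ) : ℝ → ℝ := fun x => ϕ (x - a) * Real.log (x - a)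

theorem intervalIntegrable_log_sq (b : ℝ) :
    IntervalIntegrable (fun x => Real.log x ^ 2) volume 0 b := by
  have pos : ∀ b : ℝ, 0 ≤ b → IntervalIntegrable (fun x => Real.log x ^ 2) volume 0 b := by
    intro b hb
    refine intervalIntegral.intervalIntegrable_deriv_of_nonneg
      (g := fun x => 4 * (Real.sqrt x * Real.log (Real.sqrt x)) ^ 2 - 2 * (x * Real.log x) + 2 * x)
      ?_ ?_ ?_
    · refine Continuous.continuousOn ?_
      have h1 : Continuous fun x : ℝ => Real.sqrt x * Real.log (Real.sqrt x) :=
        Real.continuous_mul_log.comp Real.continuous_sqrt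
      have h2 := Real.continuous_mul_log
      fun_prop
    · intro x hx
      rw [min_eq_left hb] at hx
      have hx0 : 0 < x := hx.1
      have hl := Real.hasDerivAt_log hx0.ne'
      have key : HasDerivAt (fun x => x * Real.log x ^ 2 - 2 * (x * Real.log x) + 2 * x)
          (Real.log x ^ 2) x := by
        refine ((((hasDerivAt_id' x).mul (hl.pow 2)).sub
          (((hasDerivAt_id' x).mul hl).const_mul 2)).add
            ((hasDerivAt_id' x).const_mul 2)).congr_deriv ?_
        simp
        field_simp
        ring
      refine key.congr_of_eventuallyEq ?_
      filter_upwards [lt_mem_nhds hx0] with y hy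
      rw [Real.log_sqrt hy.le, mul_pow, Real.sq_sqrt hy.le]
      ring
    · intro x _
      positivity
  rcases le_total 0 b with hb | hb
  · exact pos b hb
  · have h := pos (-b) (by linarith)
    rw [IntervalIntegrable.iff_comp_neg] at h
    simpa using h

theorem memLp_cutLog {ϕ : ℝ → ℝ} (hϕ : ContDiff ℝ ∞ ϕ) (hc : HasCompactSupport ϕ) (a : ℝ) :
    MemLp (cutLog ϕ a) 2 volume := by
  have hloc : LocallyIntegrable (fun x : ℝ => Real.log x ^ 2) volume := by
    rw [locallyIntegrable_iff]
    intro K hK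
    obtain ⟨R, hR⟩ := hK.isBounded.subset_closedBall 0
    rw [Real.closedBall_eq_Icc] at hR
    refine IntegrableOn.mono_set ?_ hR
    rcases le_total (0 - R) (0 + R) with h | h
    · rw [← intervalIntegrable_iff_integrableOn_Icc_of_le h]
      exact (intervalIntegrable_log_sq _).symm.trans (intervalIntegrable_log_sq _)
    · rw [IntegrableOn, Measure.restrict_zero_set
        ((Set.subsingleton_Icc_of_ge h).measure_zero volume)]
      exact integrable_zero_measure
  have hint : Integrable (fun x => ϕ x ^ 2 • Real.log x ^ 2) volume :=
    hloc.integrable_smul_left_of_hasCompactSupport (hϕ.continuous.pow 2)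
      (hc.comp_left (g := fun t : ℝ => t ^ 2) (by simp))
  have h0 : MemLp (fun x => ϕ x * Real.log x) 2 volume := by
    refine (memLp_two_iff_integrable_sq
      (hϕ.continuous.measurable.mul Real.measurable_log).aestronglyMeasurable).2 ?_
    simpa [mul_pow] using hint
  exact h0.comp_measurePreserving (measurePreserving_sub_right volume a)

end Miura

end

/-! A potential `q` has the form `u' + u²` when `u = y'/y` for a zero-free solution of `-y'' + q y =
0`. The task is therefore to produce such a solution for `q₀ + q₁` and to control its logarithmic
derivative.

Take `q₀ = u₊' + u₊²` and write the compactly supported perturbation as `s₁' + r₁` with `s₁ ∈ L²`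
and `r₁ ∈ L¹` vanishing outside a bounded interval. Then `q₀ + q₁ = s' + r` with `s = u₊ + s₁`, `r =
u₊² + r₁`, and `r = s²` to the right of some `R`. With `S' = s`, the function `e^S` solves the
equation there; it is continued to the left as `y = e^S z`, with `z = 1` on `[R, ∞)` and `(e^{2S}
z')' = (r - s²) e^{2S} z` (`exists_isSolution`). The singular term `s'` has disappeared from the
last equation.

Nonnegativity excludes zeros of `z` (`IsSolution.z_ne_zero`). Suppose `z x₀ = 0`. Cut `y` off to `0`
on the left of `x₀`, and multiply it on the right of `R` by a function falling linearly to `0` over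
a length `N`. As `s` is integrable at `+∞`, `S` is bounded above there and the energy of this trial
function is `O(1/N)`. Adding `ε` times a bump at `x₀` changes the energy to first order by a nonzero
multiple of `ε z'(x₀)`, which makes it negative unless `z'(x₀) = 0`; but a nontrivial solution has
no double zero.

So `u = s + z'/z` satisfies `u' + u² = s' + r` (`IsSolution.riccatiEq`) and equals `s` beyond `R`,
hence is integrable on `(0, ∞)`. It lies in `L²` by testing the Riccati equation with squares of
wide cutoffs (`RiccatiEq.memLp`). Reflection gives the statement at `-∞` from `u₋`.

On the distribution side, `H⁻¹ = L² + (L²)'` (`exists_eq_add_deriv`) supplies the decomposition of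
`q₁`, and density of `C₀^∞` (`ext_of_memSobolev`) upgrades identities on real test functions to
equality of distributions. Delta functions and Miura images of truncated logarithms are decomposed
explicitly. -/

namespace Miura

/-! ### Calculus of locally absolutely continuous functions -/

/-- `F` is locally absolutely continuous on the line with almost everywhere derivative `f`. -/
structure HasACDeriv (F f : ℝ → ℝ) : Prop where
  ac : ∀ a b, AbsolutelyContinuousOnInterval F a b
  ae_hasDerivAt : ∀ᵐ x, HasDerivAt F (f x) x

theorem AbsolutelyContinuousOnInterval.lipschitz_comp {F G : ℝ → ℝ} {a b : ℝ} {s : Set ℝ}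
    {K : NNReal} (hG : LipschitzOnWith K G s) (hs : ∀ x ∈ Set.uIcc a b, F x ∈ s)
    (hF : AbsolutelyContinuousOnInterval F a b) :
    AbsolutelyContinuousOnInterval (fun x => G (F x)) a b := by
  rw [absolutelyContinuousOnInterval_iff] at hF ⊢
  intro ε hε
  -- Dividing by `K + 1` rather than `K` covers `K = 0` and makes the final inequality strict.
  obtain ⟨δ, hδ, h⟩ := hF (ε / (K + 1)) (by positivity)
  refine ⟨δ, hδ, fun E hE hlen => ?_⟩
  calc ∑ i ∈ Finset.range E.1, dist (G (F (E.2 i).1)) (G (F (E.2 i).2))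
      ≤ ∑ i ∈ Finset.range E.1, K * dist (F (E.2 i).1) (F (E.2 i).2) := by
        refine Finset.sum_le_sum fun i hi => ?_
        exact hG.dist_le_mul _ (hs _ (hE.1 i hi).1) _ (hs _ (hE.1 i hi).2)
    _ = K * ∑ i ∈ Finset.range E.1, dist (F (E.2 i).1) (F (E.2 i).2) := by
        rw [Finset.mul_sum]
    _ ≤ K * (ε / (K + 1)) := by
        gcongr
        exact (h E hE hlen).le
    _ < ε := by
        have : (0 : ℝ) ≤ K := K.2
        rw [mul_div_assoc', div_lt_iff₀ (by positivity)]
        nlinarith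

namespace HasACDeriv

variable {F f G g : ℝ → ℝ}

theorem continuous (hF : HasACDeriv F f) : Continuous F := by
  refine continuous_iff_continuousAt.2 fun x => ?_
  refine ((hF.ac (x - 1) (x + 1)).continuousOn).continuousAt ?_
  rw [Set.uIcc_of_le (by linarith)]
  exact Icc_mem_nhds (by linarith) (by linarith)

theorem congr_deriv (hF : HasACDeriv F f) (h : ∀ᵐ x, f x = g x) : HasACDeriv F g :=
  ⟨hF.ac, by filter_upwards [hF.ae_hasDerivAt, h] with x h1 h2; rwa [← h2]⟩

theorem integral_eq_sub (hF : HasACDeriv F f) (a b : ℝ) : ∫ x in a..b, f x = F b - F a := by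
  rw [← (hF.ac a b).integral_deriv_eq_sub]
  refine intervalIntegral.integral_congr_ae ?_
  filter_upwards [hF.ae_hasDerivAt] with x hx _
  exact hx.deriv.symm

theorem intervalIntegrable (hF : HasACDeriv F f) (a b : ℝ) : IntervalIntegrable f volume a b := by
  refine ((hF.ac a b).intervalIntegrable_deriv).congr_ae ?_
  refine ae_restrict_of_ae ?_
  filter_upwards [hF.ae_hasDerivAt] with x hx
  exact hx.deriv

theorem mul (hF : HasACDeriv F f) (hG : HasACDeriv G g) :
    HasACDeriv (fun x => F x * G x) (fun x => f x * G x + F x * g x) :=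
  ⟨fun a b => (hF.ac a b).fun_mul (hG.ac a b), by
    filter_upwards [hF.ae_hasDerivAt, hG.ae_hasDerivAt] with x h1 h2 using h1.mul h2⟩

theorem add (hF : HasACDeriv F f) (hG : HasACDeriv G g) :
    HasACDeriv (fun x => F x + G x) (fun x => f x + g x) :=
  ⟨fun a b => (hF.ac a b).fun_add (hG.ac a b), by
    filter_upwards [hF.ae_hasDerivAt, hG.ae_hasDerivAt] with x h1 h2 using h1.add h2⟩

theorem const_mul (hF : HasACDeriv F f) (c : ℝ) :
    HasACDeriv (fun x => c * F x) (fun x => c * f x) :=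
  ⟨fun a b => (hF.ac a b).const_mul c, by
    filter_upwards [hF.ae_hasDerivAt] with x h1 using h1.const_mul c⟩

theorem of_contDiff (hF : ∀ x, HasDerivAt F (f x) x) (hf : Continuous f) : HasACDeriv F f := by
  refine ⟨fun a b => ContDiffOn.absolutelyContinuousOnInterval (ContDiff.contDiffOn ?_),
    Filter.Eventually.of_forall hF⟩
  rw [contDiff_one_iff_deriv]
  refine ⟨fun x => (hF x).differentiableAt, ?_⟩
  rwa [show deriv F = f from funext fun x => (hF x).deriv]

theorem of_locallyIntegrable (hf : LocallyIntegrable f) (c : ℝ) :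
    HasACDeriv (fun x => ∫ t in c..x, f t) f := by
  have hi : ∀ a b, IntervalIntegrable f volume a b := fun a b =>
    (hf.integrableOn_isCompact isCompact_uIcc).intervalIntegrable
  refine ⟨fun a b => ?_, ?_⟩
  · have h1 := (hi (min (min a b) c) (max (max a b) c)).absolutelyContinuousOnInterval_intervalIntegral
      (c := c) (by rw [Set.uIcc_of_le (by simp)]; simp)
    refine h1.mono ?_
    rw [Set.uIcc_of_le (a := min (min a b) c) (by simp)]
    intro x hx
    exact ⟨(min_le_left _ _).trans hx.1, hx.2.trans (le_max_left _ _)⟩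
  · filter_upwards [_root_.LocallyIntegrable.ae_hasDerivAt_integral hf] with x hx using hx c

theorem comp_contDiff {H h : ℝ → ℝ} (hH : ∀ x, HasDerivAt H (h x) x) (hh : Continuous h)
    (hF : HasACDeriv F f) : HasACDeriv (fun x => H (F x)) (fun x => h (F x) * f x) := by
  refine ⟨fun a b => ?_, ?_⟩
  · obtain ⟨C, hC⟩ := (hF.ac a b).exists_bound
    have hcd : ContDiff ℝ 1 H := by
      rw [contDiff_one_iff_deriv]
      refine ⟨fun x => (hH x).differentiableAt, ?_⟩
      rwa [show deriv H = h from funext fun x => (hH x).deriv]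
    obtain ⟨K, hK⟩ := (hcd.contDiffOn (s := Set.Icc (-C) C)).exists_lipschitzOnWith
      (by decide) (convex_Icc _ _) isCompact_Icc
    exact AbsolutelyContinuousOnInterval.lipschitz_comp hK (fun x hx => abs_le.1 (hC x hx)) (hF.ac a b)
  · filter_upwards [hF.ae_hasDerivAt] with x hx using (hH _).comp x hx

/-- Integration by parts against a compactly supported function. -/
theorem integral_mul_add_mul_eq_zero (hF : HasACDeriv F f) (hG : HasACDeriv G g)
    (hc : HasCompactSupport G) (hg : ∀ x ∉ tsupport G, g x = 0) :
    ∫ x, (f x * G x + F x * g x) = 0 := by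
  obtain ⟨R, hR⟩ := hc.isCompact.isBounded.subset_closedBall 0
  rw [Real.closedBall_eq_Icc] at hR
  -- The radius `R` may be negative; `|R| + 1` puts both endpoints strictly outside the support, so
  -- the boundary terms vanish.
  have hz : ∀ x ∉ Set.Ioc (0 - (|R| + 1)) (0 + (|R| + 1)), G x = 0 ∧ g x = 0 := by
    intro x hx
    have : x ∉ tsupport G := fun h => hx (by
      have := hR h
      constructor <;> [have := this.1; have := this.2] <;> linarith [le_abs_self R])
    exact ⟨image_eq_zero_of_notMem_tsupport this, hg x this⟩
  have h1 := (hF.mul hG).integral_eq_sub (0 - (|R| + 1)) (0 + (|R| + 1))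
  have hcont := hG.continuous
  rw [intervalIntegral.integral_of_le (by linarith [abs_nonneg R]),
    setIntegral_eq_integral_of_forall_compl_eq_zero (fun x hx => by
      rw [(hz x hx).1, (hz x hx).2]; ring)] at h1
  rw [h1]
  have ha : G (0 + (|R| + 1)) = 0 := by
    refine image_eq_zero_of_notMem_tsupport fun h => ?_
    have := (hR h).2
    linarith [le_abs_self R]
  have hb : G (0 - (|R| + 1)) = 0 := by
    refine image_eq_zero_of_notMem_tsupport fun h => ?_
    have := (hR h).1
    linarith [le_abs_self R]
  rw [ha, hb]
  ring

end HasACDeriv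

/-! ### Ordinary differential equations -/

/-- Global solvability of a scalar ODE whose right hand side is bounded and Lipschitz in the
unknown, locally uniformly in time. -/
theorem exists_global_solution {F : ℝ → ℝ → ℝ} (hcont : ∀ y, Continuous fun t => F t y) (t₀ y₀ : ℝ)
    (hb : ∀ N : ℝ, ∃ C : NNReal, ∀ t, |t - t₀| ≤ N → LipschitzWith C (F t) ∧ ∀ y, |F t y| ≤ C) :
    ∃ θ : ℝ → ℝ, θ t₀ = y₀ ∧ ∀ t, HasDerivAt θ (F t (θ t)) t := by
  have loc : ∀ n : ℕ, ∃ θ : ℝ → ℝ, θ t₀ = y₀ ∧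
      ∀ t ∈ Set.Ioo (t₀ - (n + 1)) (t₀ + (n + 1)), HasDerivAt θ (F t (θ t)) t := by
    intro n
    obtain ⟨C, hC⟩ := hb (n + 1)
    have habs : ∀ t ∈ Set.Icc (t₀ - (n + 1 : ℝ)) (t₀ + (n + 1)), |t - t₀| ≤ n + 1 := fun t ht =>
      abs_le.2 ⟨by linarith [ht.1], by linarith [ht.2]⟩
    -- With speed at most `C`, a solution moves by at most `C * (n + 1)` during time `n + 1`. A ball
    -- of that radius thus allows Picard–Lindelöf on the whole interval at once.
    have hpl : IsPicardLindelof F (tmin := t₀ - (n + 1)) (tmax := t₀ + (n + 1))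
        ⟨t₀, by constructor <;> linarith⟩ y₀ (C * (n + 1)) 0 C C := by
      refine ⟨fun t ht => (hC t (habs t ht)).1.lipschitzOnWith, fun y _ => (hcont y).continuousOn,
        fun t ht y _ => (hC t (habs t ht)).2 y, ?_⟩
      simp
    obtain ⟨θ, h0, h1⟩ := hpl.exists_eq_forall_mem_Icc_hasDerivWithinAt₀
    exact ⟨θ, h0, fun t ht => (h1 t (Set.Ioo_subset_Icc_self ht)).hasDerivAt
      (Icc_mem_nhds ht.1 ht.2)⟩
  choose θ h0 h1 using loc
  have agree : ∀ m n : ℕ, m ≤ n →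
      Set.EqOn (θ m) (θ n) (Set.Ioo (t₀ - (m + 1)) (t₀ + (m + 1))) := by
    intro m n hmn
    have hmn' : (m : ℝ) ≤ n := by exact_mod_cast hmn
    obtain ⟨C, hC⟩ := hb (m + 1)
    refine ODE_solution_unique_of_mem_Ioo (v := F) (s := fun _ => Set.univ) (K := C) (t₀ := t₀)
      (fun t ht => (hC t (abs_le.2 ⟨by linarith [ht.1], by linarith [ht.2]⟩)).1.lipschitzOnWith)
      ⟨by linarith, by linarith⟩ (fun t ht => ⟨h1 m t ht, trivial⟩)
      (fun t ht => ⟨h1 n t ⟨by linarith [ht.1], by linarith [ht.2]⟩, trivial⟩)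
      ((h0 m).trans (h0 n).symm)
  -- The solution of index `n` lives on radius `n + 1`, so the index `⌈|t - t₀|⌉₊` leaves room for a
  -- neighbourhood of `t`.
  refine ⟨fun t => θ ⌈|t - t₀|⌉₊ t, h0 _, fun t => ?_⟩
  set n := ⌈|t - t₀|⌉₊ with hn
  have hmem : ∀ x : ℝ, x ∈ Set.Ioo (t₀ - (⌈|x - t₀|⌉₊ + 1 : ℝ)) (t₀ + (⌈|x - t₀|⌉₊ + 1)) := by
    intro x
    have h := Nat.le_ceil |x - t₀|
    have h2 := abs_le.1 h
    constructor <;> linarith [h2.1, h2.2]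
  refine (h1 n t (hmem t)).congr_of_eventuallyEq ?_
  filter_upwards [isOpen_Ioo.mem_nhds (hmem t)] with x hx
  rcases le_total ⌈|x - t₀|⌉₊ n with h | h
  · exact agree _ _ h (hmem x)
  · exact (agree _ _ h hx).symm

/-- The system `z' = (W z + Q) / p`, `Q' = - W (W z + Q) / p` with continuous coefficients has a
global solution that never vanishes (in Prüfer coordinates). -/
theorem exists_solution_of_system {W p : ℝ → ℝ} (hW : Continuous W) (hp : Continuous p)
    (hp0 : ∀ x, 0 < p x) (R : ℝ) :
    ∃ z Q : ℝ → ℝ, z R = 1 ∧ Q R = 0 ∧ (∀ x, z x ≠ 0 ∨ Q x ≠ 0) ∧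
      (∀ x, HasDerivAt z ((W x * z x + Q x) / p x) x) ∧
      (∀ x, HasDerivAt Q (-(W x * (W x * z x + Q x) / p x)) x) := by
  -- Put `z = e^L sin θ` and `Q = e^L cos θ`. The equation for the angle decouples from `L` and has
  -- a right hand side bounded and Lipschitz in `θ`; `L` is then a plain integral, and `z`, `Q`
  -- cannot vanish together. The initial angle `π / 2` encodes `z R = 1`, `Q R = 0`.
  obtain ⟨θ, hθR, hθ⟩ := exists_global_solution
    (F := fun t y => (W t * Real.sin y + Real.cos y) ^ 2 / p t) (by
      intro y
      exact Continuous.div (by fun_prop) hp fun x => (hp0 x).ne') R (Real.pi / 2) (by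
      intro N
      have hc : Continuous fun t => 2 * (|W t| + 1) ^ 2 / p t :=
        Continuous.div (by fun_prop) hp fun x => (hp0 x).ne'
      obtain ⟨C, hC⟩ := (isCompact_Icc (a := R - N) (b := R + N)).exists_bound_of_continuousOn
        hc.continuousOn
      have key : ∀ t, |t - R| ≤ N → 2 * (|W t| + 1) ^ 2 / p t ≤ C.toNNReal := by
        intro t ht
        have h := abs_le.1 ht
        have := hC t ⟨by linarith [h.1], by linarith [h.2]⟩
        rw [Real.norm_eq_abs] at this
        exact (le_abs_self _).trans (this.trans (Real.le_coe_toNNReal C))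
      have hlin : ∀ t y, |W t * Real.sin y + Real.cos y| ≤ |W t| + 1 := by
        intro t y
        refine (abs_add_le _ _).trans ?_
        rw [abs_mul]
        have h1 := Real.abs_sin_le_one y
        have h2 := Real.abs_cos_le_one y
        nlinarith [abs_nonneg (W t)]
      have hlin' : ∀ t y, |W t * Real.cos y - Real.sin y| ≤ |W t| + 1 := by
        intro t y
        refine (abs_sub _ _).trans ?_
        rw [abs_mul]
        have h1 := Real.abs_sin_le_one y
        have h2 := Real.abs_cos_le_one y
        nlinarith [abs_nonneg (W t)]
      refine ⟨C.toNNReal, fun t ht => ⟨?_, fun y => ?_⟩⟩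
      · have hd : ∀ y, HasDerivAt (fun y => (W t * Real.sin y + Real.cos y) ^ 2 / p t)
            (2 * (W t * Real.sin y + Real.cos y) * (W t * Real.cos y - Real.sin y) / p t) y := by
          intro y
          have := ((((Real.hasDerivAt_sin y).const_mul (W t)).add
            (Real.hasDerivAt_cos y)).pow 2).div_const (p t)
          refine this.congr_deriv ?_
          simp
          ring
        refine lipschitzWith_of_nnnorm_deriv_le (fun y => (hd y).differentiableAt) fun y => ?_
        rw [(hd y).deriv, ← NNReal.coe_le_coe, coe_nnnorm, Real.norm_eq_abs, abs_div, abs_mul,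
          abs_mul, abs_two, abs_of_pos (hp0 t)]
        refine le_trans ?_ (key t ht)
        have := hp0 t
        rw [sq, ← mul_assoc]
        gcongr
        · exact hlin t y
        · exact hlin' t y
      · rw [abs_div, abs_of_pos (hp0 t), abs_pow]
        refine le_trans ?_ (key t ht)
        have := hp0 t
        gcongr
        have := hlin t y
        nlinarith [abs_nonneg (W t * Real.sin y + Real.cos y), abs_nonneg (W t)])
  have hθc : Continuous θ := continuous_iff_continuousAt.2 fun x => (hθ x).continuousAt
  set A : ℝ → ℝ := fun x => (W x * Real.sin (θ x) + Real.cos (θ x)) *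
    (Real.sin (θ x) - W x * Real.cos (θ x)) / p x with hA
  have hAc : Continuous A := Continuous.div (by fun_prop) hp fun x => (hp0 x).ne'
  set L : ℝ → ℝ := fun x => ∫ t in R..x, A t with hL
  have hLd : ∀ x, HasDerivAt L (A x) x := fun x =>
    intervalIntegral.integral_hasDerivAt_right (hAc.intervalIntegrable _ _)
      (hAc.stronglyMeasurableAtFilter _ _) hAc.continuousAt
  refine ⟨fun x => Real.exp (L x) * Real.sin (θ x), fun x => Real.exp (L x) * Real.cos (θ x),
    ?_, ?_, fun x => ?_, fun x => ?_, fun x => ?_⟩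
  · simp [hL, hθR]
  · simp [hθR]
  · by_contra! h
    have h1 := (mul_eq_zero.1 h.1).resolve_left (Real.exp_pos _).ne'
    have h2 := (mul_eq_zero.1 h.2).resolve_left (Real.exp_pos _).ne'
    have := Real.sin_sq_add_cos_sq (θ x)
    rw [h1, h2] at this
    norm_num at this
  · refine ((hLd x).exp.mul (hθ x).sin).congr_deriv ?_
    have := (hp0 x).ne'
    have h2 := Real.sin_sq_add_cos_sq (θ x)
    simp only [hA]
    field_simp
    linear_combination (W x * Real.sin (θ x) + Real.cos (θ x)) * h2
  · refine ((hLd x).exp.mul (hθ x).cos).congr_deriv ?_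
    have := (hp0 x).ne'
    have h2 := Real.sin_sq_add_cos_sq (θ x)
    simp only [hA]
    field_simp
    linear_combination (-W x * (W x * Real.sin (θ x) + Real.cos (θ x))) * h2

/-! ### `L²` pairings and extension of the form beyond smooth test functions -/

theorem integrable_mul_of_memLp_two {f g : ℝ → ℝ} (hf : MemLp f 2) (hg : MemLp g 2) :
    Integrable fun x => f x * g x :=
  hf.integrable_mul hg

theorem memLp_mul_of_abs_le {f g : ℝ → ℝ} (hf : MemLp f 2) (hg : AEStronglyMeasurable g) {K : ℝ}
    (hK : ∀ x, |g x| ≤ K) : MemLp (fun x => f x * g x) 2 := by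
  refine hf.of_le_mul (c := K) (hf.aestronglyMeasurable.mul hg) (.of_forall fun x => ?_)
  rw [norm_mul, mul_comm]
  exact mul_le_mul_of_nonneg_right (hK x) (norm_nonneg _)

theorem abs_integral_mul_le {f g : ℝ → ℝ} (hf : MemLp f 2) (hg : MemLp g 2) :
    |∫ x, f x * g x| ≤ √(∫ x, f x ^ 2) * √(∫ x, g x ^ 2) := by
  have h := integral_mul_le_Lp_mul_Lq_of_nonneg (μ := volume) Real.HolderConjugate.two_two
    (f := fun x => |f x|) (g := fun x => |g x|) (.of_forall fun _ => abs_nonneg _)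
    (.of_forall fun _ => abs_nonneg _) (by rw [ENNReal.ofReal_ofNat]; exact hf.abs)
    (by rw [ENNReal.ofReal_ofNat]; exact hg.abs)
  rw [← Real.sqrt_eq_rpow, ← Real.sqrt_eq_rpow] at h
  simp only [Real.rpow_two, sq_abs] at h
  refine le_trans ?_ h
  simp_rw [← abs_mul]
  exact abs_integral_le_integral_abs

theorem tendsto_integral_mul {f g : ℝ → ℝ} {F G : ℕ → ℝ → ℝ} (hf : MemLp f 2) (hg : MemLp g 2)
    (hF : ∀ n, MemLp (F n) 2) (hG : ∀ n, MemLp (G n) 2)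
    (hFf : Filter.Tendsto (fun n => ∫ x, (F n x - f x) ^ 2) .atTop (nhds 0))
    (hGg : Filter.Tendsto (fun n => ∫ x, (G n x - g x) ^ 2) .atTop (nhds 0)) :
    Filter.Tendsto (fun n => ∫ x, F n x * G n x) .atTop (nhds (∫ x, f x * g x)) := by
  have hd : ∀ n, MemLp (fun x => F n x - f x) 2 := fun n => (hF n).sub hf
  have he : ∀ n, MemLp (fun x => G n x - g x) 2 := fun n => (hG n).sub hg
  have h1 := hFf.sqrt
  have h2 := hGg.sqrt
  rw [Real.sqrt_zero] at h1 h2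
  rw [tendsto_iff_norm_sub_tendsto_zero]
  have hlim : Filter.Tendsto (fun n => √(∫ x, (F n x - f x) ^ 2) * √(∫ x, (G n x - g x) ^ 2) +
      √(∫ x, (F n x - f x) ^ 2) * √(∫ x, g x ^ 2) +
      √(∫ x, f x ^ 2) * √(∫ x, (G n x - g x) ^ 2)) .atTop (nhds 0) := by
    have := ((h1.mul h2).add (h1.mul_const (√(∫ x, g x ^ 2)))).add
      (h2.const_mul (√(∫ x, f x ^ 2)))
    simpa using this
  refine squeeze_zero (fun n => norm_nonneg _) (fun n => ?_) hlim
  have hsplit : (∫ x, F n x * G n x) - ∫ x, f x * g x =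
      (∫ x, (F n x - f x) * (G n x - g x)) + (∫ x, (F n x - f x) * g x) +
        ∫ x, f x * (G n x - g x) := by
    have i1 := integrable_mul_of_memLp_two (hd n) (he n)
    have i2 := integrable_mul_of_memLp_two (hd n) hg
    have i3 := integrable_mul_of_memLp_two hf (he n)
    have i12 : Integrable fun x => (F n x - f x) * (G n x - g x) + (F n x - f x) * g x :=
      i1.add i2
    have i4 := integrable_mul_of_memLp_two (hF n) (hG n)
    have i5 := integrable_mul_of_memLp_two hf hg
    rw [← integral_add i1 i2, ← integral_add i12 i3, ← integral_sub i4 i5]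
    congr 1
    funext x
    ring
  rw [hsplit, Real.norm_eq_abs]
  refine (abs_add_le _ _).trans (add_le_add ((abs_add_le _ _).trans (add_le_add ?_ ?_)) ?_)
  · exact abs_integral_mul_le (hd n) (he n)
  · exact abs_integral_mul_le (hd n) hg
  · exact abs_integral_mul_le hf (he n)

theorem integral_sq_le_of_eLpNorm_le {f : ℝ → ℝ} (hf : MemLp f 2) {δ : ℝ} (hδ : 0 ≤ δ)
    (h : eLpNorm f 2 volume ≤ ENNReal.ofReal δ) : ∫ x, f x ^ 2 ≤ δ ^ 2 := by
  have h1 : eLpNorm f 2 volume = ENNReal.ofReal (√(∫ x, f x ^ 2)) := by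
    rw [hf.eLpNorm_eq_integral_rpow_norm (by norm_num) (by norm_num), Real.sqrt_eq_rpow]
    simp
  rw [h1, ENNReal.ofReal_le_ofReal_iff hδ] at h
  exact (Real.sqrt_le_left hδ).1 h

/-- `L²` functions supported in an interval with mean zero are limits of smooth functions
of mean zero with uniformly bounded supports. -/
theorem exists_smooth_mean_zero_approx {g : ℝ → ℝ} {a b : ℝ} (hab : a < b) (hg : MemLp g 2)
    (hg0 : ∀ x ∉ Set.Icc a b, g x = 0) (hgi : ∫ x, g x = 0) {ε : ℝ} (hε : 0 < ε) :
    ∃ G : ℝ → ℝ, ContDiff ℝ ∞ G ∧ (∀ x ∉ Set.Icc (a - 1) (b + 1), G x = 0) ∧ ∫ x, G x = 0 ∧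
      ∫ x, (G x - g x) ^ 2 ≤ ε := by
  let χ : ContDiffBump ((a + b) / 2) := ⟨(b - a) / 2, (b - a) / 2 + 1, by linarith, by linarith⟩
  have hχ1 : ∀ x ∈ Set.Icc a b, χ x = 1 := by
    intro x hx
    refine χ.one_of_mem_closedBall ?_
    rw [Real.closedBall_eq_Icc]
    change x ∈ Set.Icc ((a + b) / 2 - (b - a) / 2) ((a + b) / 2 + (b - a) / 2)
    constructor <;> linarith [hx.1, hx.2]
  have hχ0 : ∀ x ∉ Set.Icc (a - 1) (b + 1), χ x = 0 := by
    intro x hx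
    by_contra h
    have hm : x ∈ Function.support χ := h
    rw [χ.support_eq, Real.ball_eq_Ioo] at hm
    refine hx ⟨?_, ?_⟩
    · have : (a + b) / 2 - ((b - a) / 2 + 1) < x := hm.1
      linarith
    · have : x < (a + b) / 2 + ((b - a) / 2 + 1) := hm.2
      linarith
  have hχm : MemLp χ 2 := χ.continuous.memLp_of_hasCompactSupport χ.hasCompactSupport
  set I := ∫ x, χ x with hI
  have hIpos : 0 < I := χ.integral_pos
  set X := ∫ x, χ x ^ 2 with hX
  have hX0 : 0 ≤ X := integral_nonneg fun x => sq_nonneg _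
  -- The approximant is `χ (k - m)`, with `k` close to `g` in `L²` and `m` chosen to make the mean
  -- zero. As `g` has mean zero and `χ = 1` where `g` lives, `m I = -∫ χ (g - k)`, so Cauchy–Schwarz
  -- gives `m² ≤ X ∫ (g - k)² / I²`. `C` collects this error and that of `k`.
  set C := 2 + 2 * X ^ 2 / I ^ 2 with hC
  have hC0 : 0 < C := by positivity
  obtain ⟨k, hkc, hks, hk⟩ := hg.exist_eLpNorm_sub_le (by norm_num) (by norm_num)
    (ε := √(ε / C)) (by positivity)
  have hkm : MemLp k 2 := hks.continuous.memLp_of_hasCompactSupport hkc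
  have hdm : MemLp (fun x => g x - k x) 2 := hg.sub hkm
  have hδ := integral_sq_le_of_eLpNorm_le hdm (Real.sqrt_nonneg _) hk
  rw [Real.sq_sqrt (by positivity)] at hδ
  set m := (∫ x, χ x * k x) / I with hm
  have hχg : ∀ x, χ x * g x = g x := by
    intro x
    by_cases hx : x ∈ Set.Icc a b
    · rw [hχ1 x hx, one_mul]
    · rw [hg0 x hx, mul_zero]
  have hχk : Integrable fun x => χ x * k x := hχm.integrable_mul hkm
  have hχi : Integrable χ := χ.continuous.integrable_of_hasCompactSupport χ.hasCompactSupport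
  refine ⟨fun x => χ x * (k x - m), χ.contDiff.mul (hks.sub contDiff_const), fun x hx => by
    simp only [hχ0 x hx, zero_mul], ?_, ?_⟩
  · simp_rw [mul_sub]
    rw [integral_sub hχk (hχi.mul_const _), integral_mul_const, ← hI, hm]
    field_simp
    ring
  · have hmI : m * I = -∫ x, χ x * (g x - k x) := by
      simp_rw [mul_sub, hχg]
      rw [integral_sub (by simpa only [hχg] using integrable_mul_of_memLp_two hχm hg) hχk, hgi, hm]
      field_simp
      ring
    have hm2 : m ^ 2 * I ^ 2 ≤ X * ∫ x, (g x - k x) ^ 2 := by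
      rw [← mul_pow, hmI, neg_sq, ← sq_abs]
      refine (pow_le_pow_left₀ (abs_nonneg _) (abs_integral_mul_le hχm hdm) 2).trans ?_
      rw [mul_pow, Real.sq_sqrt hX0, Real.sq_sqrt (integral_nonneg fun x => sq_nonneg _)]
    have hpt : ∀ x, (χ x * (k x - m) - g x) ^ 2 ≤ 2 * (g x - k x) ^ 2 + 2 * m ^ 2 * χ x ^ 2 := by
      intro x
      have h1 : χ x * (k x - m) - g x = -(χ x * (g x - k x)) - m * χ x := by
        linear_combination hχg x
      have h2 : (χ x * (g x - k x)) ^ 2 ≤ (g x - k x) ^ 2 := by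
        rw [mul_pow]
        have := χ.nonneg (x := x)
        have := χ.le_one (x := x)
        exact mul_le_of_le_one_left (sq_nonneg _) (by nlinarith)
      rw [h1]
      nlinarith [sq_nonneg (χ x * (g x - k x) - m * χ x)]
    have hi1 : Integrable fun x => 2 * (g x - k x) ^ 2 := hdm.integrable_sq.const_mul 2
    have hi2 : Integrable fun x => 2 * m ^ 2 * χ x ^ 2 := hχm.integrable_sq.const_mul _
    calc ∫ x, (χ x * (k x - m) - g x) ^ 2
        ≤ ∫ x, (2 * (g x - k x) ^ 2 + 2 * m ^ 2 * χ x ^ 2) :=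
          integral_mono_of_nonneg (.of_forall fun x => sq_nonneg _) (hi1.add hi2)
            (.of_forall hpt)
      _ = 2 * (∫ x, (g x - k x) ^ 2) + 2 * m ^ 2 * X := by
          rw [integral_add hi1 hi2, integral_const_mul, integral_const_mul]
      _ ≤ C * ∫ x, (g x - k x) ^ 2 := by
          have : m ^ 2 ≤ X * (∫ x, (g x - k x) ^ 2) / I ^ 2 := by
            rw [le_div_iff₀ (by positivity)]
            exact hm2
          have h3 := mul_le_mul_of_nonneg_right this hX0
          have : C * ∫ x, (g x - k x) ^ 2 = 2 * (∫ x, (g x - k x) ^ 2) +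
            2 * (X * (∫ x, (g x - k x) ^ 2) / I ^ 2 * X) := by
            rw [hC]
            field_simp
          rw [this]
          nlinarith
      _ ≤ C * (ε / C) := by gcongr
      _ = ε := by field_simp

/-- The quadratic form `∫ φ'² + ∫ r φ² - ∫ s (φ²)'` of `-d²/dx² + (s' + r)` is nonnegative on real
test functions. -/
def FormNonneg (r s : ℝ → ℝ) : Prop :=
  ∀ φ : ℝ → ℝ, ContDiff ℝ ∞ φ → HasCompactSupport φ →
    0 ≤ (∫ x, deriv φ x ^ 2) + (∫ x, r x * φ x ^ 2) - ∫ x, s x * (2 * φ x * deriv φ x)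

/-- The trial functions needed later have only an `L²` derivative. Approximating the derivative by
smooth functions of mean zero makes the primitives compactly supported test functions, and the form
passes to the limit. -/
theorem FormNonneg.of_memLp {r s : ℝ → ℝ} (hr : Integrable r) (hs : MemLp s 2)
    (hpos : FormNonneg r s) {a b : ℝ} (hab : a < b) {g : ℝ → ℝ} (hg : MemLp g 2)
    (hg0 : ∀ x ∉ Set.Icc a b, g x = 0) (hgi : ∫ x, g x = 0) {φ : ℝ → ℝ}
    (hφ : ∀ x, φ x = ∫ t in a..x, g t) :
    0 ≤ (∫ x, g x ^ 2) + (∫ x, r x * φ x ^ 2) - ∫ x, s x * (2 * φ x * g x) := by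
  have happ := fun n : ℕ => exists_smooth_mean_zero_approx hab hg hg0 hgi
    (ε := 1 / ((n : ℝ) + 1)) (by positivity)
  choose G hGs hG0 hGi hGa using happ
  set a' := a - 1 with ha'
  set b' := b + 1 with hb'
  have hGcs : ∀ n, HasCompactSupport (G n) := fun n =>
    HasCompactSupport.intro isCompact_Icc (hG0 n)
  have hGm : ∀ n, MemLp (G n) 2 := fun n =>
    (hGs n).continuous.memLp_of_hasCompactSupport (hGcs n)
  have hGint : ∀ n, Integrable (G n) := fun n =>
    (hGs n).continuous.integrable_of_hasCompactSupport (hGcs n)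
  have hgint : Integrable g := by
    have : IntegrableOn g (Set.Icc a b) :=
      (hg.restrict _).integrable (by norm_num)
    exact (integrableOn_iff_integrable_of_support_subset (fun x hx => by
      by_contra h
      exact hx (hg0 x h))).1 this
  set Φ : ℕ → ℝ → ℝ := fun n x => ∫ t in a'..x, G n t with hΦ
  have hφ' : ∀ x, φ x = ∫ t in a'..x, g t := by
    intro x
    rw [hφ, ← intervalIntegral.integral_add_adjacent_intervals (a := a') (b := a) (c := x)
      hgint.intervalIntegrable hgint.intervalIntegrable]
    refine (add_eq_right.2 (intervalIntegral.integral_zero_ae ?_)).symm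
    filter_upwards [Measure.ae_ne volume a] with x hxa hx
    rw [Set.uIoc_of_le (by linarith)] at hx
    exact hg0 x fun h => hxa (le_antisymm hx.2 h.1)
  have hdΦ : ∀ n x, HasDerivAt (Φ n) (G n x) x := fun n x =>
    intervalIntegral.integral_hasDerivAt_right ((hGint n).intervalIntegrable)
      ((hGs n).continuous.stronglyMeasurableAtFilter _ _) (hGs n).continuous.continuousAt
  have hderiv : ∀ n, deriv (Φ n) = G n := fun n => funext fun x => (hdΦ n x).deriv
  have hΦs : ∀ n, ContDiff ℝ ∞ (Φ n) := by
    intro n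
    rw [contDiff_infty_iff_deriv]
    exact ⟨fun x => (hdΦ n x).differentiableAt, by rw [hderiv]; exact hGs n⟩
  have hΦ0 : ∀ n, ∀ x ∉ Set.Icc a' b', Φ n x = 0 := by
    intro n x hx
    rcases lt_or_ge x a' with h | h
    · refine intervalIntegral.integral_zero_ae (.of_forall fun t ht => ?_)
      rw [Set.uIoc_of_ge h.le] at ht
      by_cases hta : t = a'
      -- Vanishing off the closed interval leaves out the endpoint `a'`; continuity supplies it.
      · have : Set.EqOn (G n) 0 (closure (Set.Iio a')) := by
          refine Set.EqOn.closure (fun y hy => hG0 n y fun hh => ?_) (hGs n).continuous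
            continuous_const
          exact absurd hh.1 (not_le.2 hy)
        rw [closure_Iio] at this
        exact this ht.2
      · exact hG0 n t fun hh => hta (le_antisymm ht.2 hh.1)
    · have hb : b' < x := by
        by_contra hh
        exact hx ⟨h, not_lt.1 hh⟩
      have : ∫ t in a'..x, G n t = ∫ t, G n t := by
        refine intervalIntegral.integral_eq_integral_of_support_subset fun t ht => ?_
        have htm : t ∈ Set.Icc a' b' := by
          by_contra hh
          exact ht (hG0 n t hh)
        refine ⟨lt_of_le_of_ne htm.1 fun hh => ?_, htm.2.trans hb.le⟩
        have : Set.EqOn (G n) 0 (closure (Set.Iio a')) := by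
          refine Set.EqOn.closure (fun y hy => hG0 n y fun hh => ?_) (hGs n).continuous
            continuous_const
          exact absurd hh.1 (not_le.2 hy)
        rw [closure_Iio] at this
        exact ht (this hh.ge)
      simp only [hΦ, this, hGi]
  have hΦc : ∀ n, HasCompactSupport (Φ n) := fun n => HasCompactSupport.intro isCompact_Icc (hΦ0 n)
  have hLim : Filter.Tendsto (fun n => ∫ x, (G n x - g x) ^ 2) .atTop (nhds 0) :=
    squeeze_zero (fun n => integral_nonneg fun x => sq_nonneg _) hGa
      tendsto_one_div_add_atTop_nhds_zero_nat
  set J : ℝ → ℝ := Set.indicator (Set.Icc a' b') 1 with hJ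
  have hJm : MemLp J 2 := memLp_indicator_const 2 measurableSet_Icc 1 (Or.inr (by simp))
  set e : ℕ → ℝ := fun n => √(∫ x, J x ^ 2) * √(∫ x, (G n x - g x) ^ 2) with he
  have he0 : Filter.Tendsto e .atTop (nhds 0) := by
    have := (hLim.sqrt).const_mul (√(∫ x, J x ^ 2))
    simpa using this
  -- All `G n` and `g` live on one bounded interval. Cauchy–Schwarz against its indicator turns `L²`
  -- convergence of derivatives into uniform convergence of primitives, which is what the terms with
  -- `r ∈ L¹` and `s ∈ L²` require.
  have hunif : ∀ n x, |Φ n x - φ x| ≤ e n := by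
    intro n x
    have hdm : MemLp (fun x => |G n x - g x|) 2 := ((hGm n).sub hg).abs
    rw [hφ', hΦ, ← intervalIntegral.integral_sub (hGint n).intervalIntegrable
      hgint.intervalIntegrable]
    calc |∫ t in a'..x, (G n t - g t)| ≤ ∫ t in Set.uIoc a' x, |G n t - g t| := by
          have := intervalIntegral.norm_integral_le_integral_norm_uIoc
            (f := fun t => G n t - g t) (a := a') (b := x) (μ := volume)
          simpa only [Real.norm_eq_abs] using this
      _ ≤ ∫ t, |G n t - g t| :=
          setIntegral_le_integral ((hGint n).sub hgint).abs (.of_forall fun t => abs_nonneg _)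
      _ = ∫ t, J t * |G n t - g t| := by
          refine integral_congr_ae (.of_forall fun t => ?_)
          by_cases ht : t ∈ Set.Icc a' b'
          · simp [hJ, ht]
          · have : g t = 0 := hg0 t fun hh => ht ⟨by linarith [hh.1], by linarith [hh.2]⟩
            simp [hJ, ht, hG0 n t ht, this]
      _ ≤ e n := by
          refine (le_abs_self _).trans ((abs_integral_mul_le hJm hdm).trans ?_)
          simp [he]
  obtain ⟨E, hE⟩ := he0.bddAbove_range
  have hφc : Continuous φ := by
    have := (HasACDeriv.of_locallyIntegrable hgint.locallyIntegrable a).continuous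
    rwa [show φ = fun x => ∫ t in a..x, g t from funext hφ]
  have hφb : ∀ x, |φ x| ≤ ∫ t, |g t| := by
    intro x
    rw [hφ]
    have := intervalIntegral.norm_integral_le_integral_norm_uIoc
            (f := g) (a := a) (b := x) (μ := volume)
    exact this.trans (setIntegral_le_integral hgint.abs (.of_forall fun t => abs_nonneg _))
  set M := ∫ t, |g t| with hM
  have hΦb : ∀ n x, |Φ n x| ≤ M + E := by
    intro n x
    have h1 := hunif n x
    have h2 : e n ≤ E := hE ⟨n, rfl⟩
    have h3 := hφb x
    have : |Φ n x| ≤ |Φ n x - φ x| + |φ x| := by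
      simpa using abs_add_le (Φ n x - φ x) (φ x)
    linarith
  have hpt : ∀ x, Filter.Tendsto (fun n => Φ n x) .atTop (nhds (φ x)) := fun x => by
    rw [tendsto_iff_norm_sub_tendsto_zero]
    exact squeeze_zero (fun n => norm_nonneg _) (fun n => hunif n x) he0
  have L1 : Filter.Tendsto (fun n => ∫ x, G n x * G n x) .atTop (nhds (∫ x, g x * g x)) :=
    tendsto_integral_mul hg hg hGm hGm hLim hLim
  have L2 : Filter.Tendsto (fun n => ∫ x, r x * Φ n x ^ 2) .atTop (nhds (∫ x, r x * φ x ^ 2)) := by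
    refine tendsto_integral_of_dominated_convergence (fun x => |r x| * (M + E) ^ 2)
      (fun n => hr.aestronglyMeasurable.mul ((hΦs n).continuous.pow 2).aestronglyMeasurable)
      (hr.abs.mul_const _) (fun n => .of_forall fun x => ?_) (.of_forall fun x => ?_)
    · rw [Real.norm_eq_abs, abs_mul, abs_pow]
      gcongr
      exact hΦb n x
    · exact ((hpt x).pow 2).const_mul _
  have hsφ : ∀ ψ : ℝ → ℝ, Continuous ψ → ∀ K, (∀ x, |ψ x| ≤ K) → MemLp (fun x => s x * ψ x) 2 := by
    intro ψ hψ K hK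
    exact memLp_mul_of_abs_le hs hψ.aestronglyMeasurable hK
  have L3 : Filter.Tendsto (fun n => ∫ x, (s x * Φ n x) * G n x) .atTop
      (nhds (∫ x, (s x * φ x) * g x)) := by
    refine tendsto_integral_mul (hsφ φ hφc M hφb) hg
      (fun n => hsφ (Φ n) (hΦs n).continuous _ (hΦb n)) hGm ?_ hLim
    have hlim : Filter.Tendsto (fun n => e n ^ 2 * ∫ x, s x ^ 2) .atTop (nhds 0) := by
      simpa using (he0.pow 2).mul_const (∫ x, s x ^ 2)
    refine squeeze_zero (fun n => integral_nonneg fun x => sq_nonneg _) (fun n => ?_) hlim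
    rw [← integral_const_mul]
    refine integral_mono_of_nonneg (.of_forall fun x => sq_nonneg _)
      (hs.integrable_sq.const_mul _) (.of_forall fun x => ?_)
    have h1 := pow_le_pow_left₀ (abs_nonneg _) (hunif n x) 2
    rw [sq_abs] at h1
    calc (s x * Φ n x - s x * φ x) ^ 2 = (Φ n x - φ x) ^ 2 * s x ^ 2 := by ring
      _ ≤ _ := mul_le_mul_of_nonneg_right h1 (sq_nonneg _)
  have hfin := (L1.add L2).sub (L3.const_mul 2)
  have hform : ∀ ψ h : ℝ → ℝ,
      (∫ x, h x ^ 2) + (∫ x, r x * ψ x ^ 2) - ∫ x, s x * (2 * ψ x * h x) =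
      (∫ x, h x * h x) + (∫ x, r x * ψ x ^ 2) - 2 * ∫ x, (s x * ψ x) * h x := by
    intro ψ h
    rw [← integral_const_mul]
    congr 2
    · congr 1
      funext x
      ring
    · funext x
      ring
  rw [hform]
  refine ge_of_tendsto' hfin fun n => ?_
  rw [← hform]
  have := hpos (Φ n) (hΦs n) (hΦc n)
  rwa [hderiv] at this

/-! ### The zero-free solution -/

/-- A solution `y = e^S z` of `-y'' + (s' + r) y = 0` with `S' = s`, which is a multiple of `e^S`
to the right of `R`, where `r = s²`. Here `P = e^{2S} z'`. -/
structure IsSolution (r s S z P : ℝ → ℝ) (R : ℝ) : Prop where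
  hasACDeriv_S : HasACDeriv S s
  hasACDeriv_P : HasACDeriv P fun x => (r x - s x ^ 2) * Real.exp (2 * S x) * z x
  hasDerivAt_z : ∀ x, HasDerivAt z (P x * Real.exp (-2 * S x)) x
  ne_zero : ∀ x, z x ≠ 0 ∨ P x ≠ 0
  z_eq_one : ∀ x, R ≤ x → z x = 1
  P_eq_zero : ∀ x, R ≤ x → P x = 0

theorem exp_two_mul_exp_neg (t : ℝ) : Real.exp (2 * t) * Real.exp (-2 * t) = 1 := by
  rw [← Real.exp_add]
  simp

/-- The coefficient `w = (r - s²) e^{2S}` is only locally integrable. With `W' = w` and `Q = P - W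
z`, the equations `P' = w z`, `z' = e^{-2S} P` become `z' = e^{-2S} (W z + Q)`, `Q' = -W z'`, a
system with continuous coefficients. Since `w = 0` beyond `R`, the data at `R` persist to the right.
-/
theorem exists_isSolution {r s S : ℝ → ℝ} {R : ℝ} (hS : HasACDeriv S s)
    (hrs : LocallyIntegrable fun x => r x - s x ^ 2) (hR : ∀ x, R < x → r x = s x ^ 2) :
    ∃ z P, IsSolution r s S z P R := by
  have hSc := hS.continuous
  set w : ℝ → ℝ := fun x => (r x - s x ^ 2) * Real.exp (2 * S x) with hw
  have hwi : LocallyIntegrable w := hrs.mul_continuous (by fun_prop)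
  set W : ℝ → ℝ := fun x => ∫ t in R..x, w t with hWdef
  have hW : HasACDeriv W w := HasACDeriv.of_locallyIntegrable hwi R
  have hWc := hW.continuous
  have hW0 : ∀ x, R ≤ x → W x = 0 := by
    intro x hx
    refine intervalIntegral.integral_zero_ae (.of_forall fun t ht => ?_)
    rw [Set.uIoc_of_le hx] at ht
    simp [hw, hR t ht.1]
  obtain ⟨z, Q, hzR, hQR, hne, hz, hQ⟩ := exists_solution_of_system (W := W)
    (p := fun x => Real.exp (2 * S x)) hWc (by fun_prop) (fun x => Real.exp_pos _) R
  have hdiv : ∀ x y : ℝ, y / Real.exp (2 * S x) = y * Real.exp (-2 * S x) := by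
    intro x y
    rw [div_eq_iff (Real.exp_pos _).ne', mul_assoc, mul_comm (Real.exp (-2 * S x)),
      exp_two_mul_exp_neg, mul_one]
  simp only [hdiv] at hz hQ
  have hzc : Continuous z := continuous_iff_continuousAt.2 fun x => (hz x).continuousAt
  have hQc : Continuous Q := continuous_iff_continuousAt.2 fun x => (hQ x).continuousAt
  have hzAC := HasACDeriv.of_contDiff hz (by fun_prop)
  have hQAC := HasACDeriv.of_contDiff hQ (by fun_prop)
  have hQ0 : ∀ x, R ≤ x → Q x = 0 := by
    intro x hx
    have h := hQAC.integral_eq_sub R x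
    rw [hQR, sub_zero] at h
    rw [← h]
    refine intervalIntegral.integral_zero_ae (.of_forall fun t ht => ?_)
    rw [Set.uIoc_of_le hx] at ht
    simp [hW0 t ht.1.le]
  have hz1 : ∀ x, R ≤ x → z x = 1 := by
    intro x hx
    have h := hzAC.integral_eq_sub R x
    rw [hzR] at h
    have h0 : ∫ t in R..x, (W t * z t + Q t) * Real.exp (-2 * S t) = 0 := by
      refine intervalIntegral.integral_zero_ae (.of_forall fun t ht => ?_)
      rw [Set.uIoc_of_le hx] at ht
      simp [hW0 t ht.1.le, hQ0 t ht.1.le]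
    linarith
  refine ⟨z, fun x => W x * z x + Q x, hS, ?_, hz, fun x => ?_, hz1, fun x hx => ?_⟩
  · refine ((hW.mul hzAC).add hQAC).congr_deriv (.of_forall fun x => ?_)
    ring
  · rcases hne x with h | h
    · exact .inl h
    · by_cases hz0 : z x = 0
      · right
        simpa [hz0] using h
      · exact .inl hz0
  · simp [hW0 x hx, hQ0 x hx]

theorem memLp_indicator_Ioc {f : ℝ → ℝ} (hf : Continuous f) (a b : ℝ) :
    MemLp ((Set.Ioc a b).indicator f) 2 := by
  rw [memLp_indicator_iff_restrict measurableSet_Ioc]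
  obtain ⟨C, hC⟩ := (isCompact_Icc (a := a) (b := b)).exists_bound_of_continuousOn hf.continuousOn
  refine MemLp.of_bound hf.aestronglyMeasurable C ?_
  refine (ae_restrict_mem measurableSet_Ioc).mono fun x hx => hC x (Set.Ioc_subset_Icc_self hx)

namespace IsSolution

variable {r s S z P : ℝ → ℝ} {R : ℝ}

theorem continuous_z (h : IsSolution r s S z P R) : Continuous z :=
  continuous_iff_continuousAt.2 fun x => (h.hasDerivAt_z x).continuousAt

theorem continuous_deriv (h : IsSolution r s S z P R) :
    Continuous fun x => P x * Real.exp (-2 * S x) := by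
  have := h.hasACDeriv_S.continuous
  have := h.hasACDeriv_P.continuous
  fun_prop

theorem hasACDeriv_z (h : IsSolution r s S z P R) :
    HasACDeriv z fun x => P x * Real.exp (-2 * S x) :=
  .of_contDiff h.hasDerivAt_z h.continuous_deriv

/-- The quadratic form in the variable `ψ = e^{-S} φ`. -/
theorem _root_.Miura.FormNonneg.exp_mul (hr : Integrable r) (hs : MemLp s 2)
    (hpos : FormNonneg r s) (hS : HasACDeriv S s) {ψ h : ℝ → ℝ} (hψ : HasACDeriv ψ h) {a b : ℝ}
    (hab : a < b) (hψ0 : ∀ x ∉ Set.Ioo a b, ψ x = 0) (hh0 : ∀ x ∉ Set.Icc a b, h x = 0)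
    (hh : MemLp (fun x => Real.exp (S x) * h x) 2) :
    Integrable (fun x => Real.exp (2 * S x) * h x ^ 2 +
      (r x - s x ^ 2) * Real.exp (2 * S x) * ψ x ^ 2) ∧
    0 ≤ ∫ x, (Real.exp (2 * S x) * h x ^ 2 +
      (r x - s x ^ 2) * Real.exp (2 * S x) * ψ x ^ 2) := by
  have hSc := hS.continuous
  have hψc := hψ.continuous
  set φ : ℝ → ℝ := fun x => Real.exp (S x) * ψ x with hφ
  set g : ℝ → ℝ := fun x => Real.exp (S x) * h x + s x * φ x with hg
  have hφc : Continuous φ := by fun_prop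
  have hφAC : HasACDeriv φ g := by
    refine ((HasACDeriv.comp_contDiff Real.hasDerivAt_exp Real.continuous_exp hS).mul
      hψ).congr_deriv (.of_forall fun x => ?_)
    simp only [hg, hφ]
    ring
  have hφ0 : ∀ x ∉ Set.Ioo a b, φ x = 0 := fun x hx => by simp [hφ, hψ0 x hx]
  have hφcs : HasCompactSupport φ := HasCompactSupport.intro (isCompact_Icc (a := a) (b := b))
    fun x hx => hφ0 x fun hh => hx (Set.Ioo_subset_Icc_self hh)
  obtain ⟨K, hK⟩ := hφcs.exists_bound_of_continuous hφc
  have hsφ : MemLp (fun x => s x * φ x) 2 := memLp_mul_of_abs_le hs hφc.aestronglyMeasurable hK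
  have hgm : MemLp g 2 := hh.add hsφ
  have hg0 : ∀ x ∉ Set.Icc a b, g x = 0 := fun x hx => by
    simp only [hg]
    rw [hh0 x hx, hφ0 x fun hh => hx (Set.Ioo_subset_Icc_self hh)]
    ring
  have hφa : φ a = 0 := hφ0 a (by simp)
  have hφb : φ b = 0 := hφ0 b (by simp)
  have hφint : ∀ x, φ x = ∫ t in a..x, g t := fun x => by
    rw [hφAC.integral_eq_sub, hφa, sub_zero]
  have hgi : ∫ x, g x = 0 := by
    have h1 := hφint b
    rw [hφb, intervalIntegral.integral_of_le hab.le, ← integral_Icc_eq_integral_Ioc,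
      setIntegral_eq_integral_of_forall_compl_eq_zero hg0] at h1
    exact h1.symm
  have key := hpos.of_memLp hr hs hab hgm hg0 hgi hφint
  have i1 : Integrable fun x => g x ^ 2 := hgm.integrable_sq
  have i2 : Integrable fun x => r x * φ x ^ 2 := by
    refine hr.mul_bdd (c := K ^ 2) (hφc.pow 2).aestronglyMeasurable (.of_forall fun x => ?_)
    rw [norm_pow]
    exact pow_le_pow_left₀ (norm_nonneg _) (hK x) 2
  have i3 : Integrable fun x => s x * (2 * φ x * g x) := by
    refine ((integrable_mul_of_memLp_two hsφ hgm).const_mul 2).congr (.of_forall fun x => ?_)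
    ring
  have i12 : Integrable fun x => g x ^ 2 + r x * φ x ^ 2 := i1.add i2
  -- Completing the square: the integrand is `(g - s φ)² + (r - s²) φ²`, and `g - s φ = e^S h`.
  have hpt : ∀ x, g x ^ 2 + r x * φ x ^ 2 - s x * (2 * φ x * g x) = Real.exp (2 * S x) * h x ^ 2 +
      (r x - s x ^ 2) * Real.exp (2 * S x) * ψ x ^ 2 := by
    intro x
    have : Real.exp (2 * S x) = Real.exp (S x) ^ 2 := by
      rw [← Real.exp_nat_mul]
      norm_num
    simp only [hg, hφ, this]
    ring
  rw [← integral_add i1 i2, ← integral_sub i12 i3] at key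
  have i123 := i12.sub i3
  simp_rw [hpt] at key
  exact ⟨i123.congr (.of_forall hpt), key⟩

/-- If `-d²/dx² + (s' + r)` is nonnegative, then its solution that is bounded at `+∞` has no
zeros. -/
theorem z_ne_zero (h : IsSolution r s S z P R) (hr : Integrable r) (hs : MemLp s 2)
    (hpos : FormNonneg r s) (hR : ∀ x, R < x → r x = s x ^ 2) {B : ℝ} (hB : ∀ x, R ≤ x → S x ≤ B)
    (x₀ : ℝ) : z x₀ ≠ 0 := by
  intro hz0
  have hx₀ : x₀ < R := by
    by_contra! hx
    rw [h.z_eq_one _ hx] at hz0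
    exact one_ne_zero hz0
  have hSc := h.hasACDeriv_S.continuous
  have hPc := h.hasACDeriv_P.continuous
  have hzc := h.continuous_z
  set d := R - x₀ with hd
  have hd0 : 0 < d := by linarith
  -- The support of `η` stays to the right of `a = x₀ - d` and to the left of `R`, so the
  -- perturbation does not meet the linear cutoff.
  let η : ContDiffBump x₀ := ⟨d / 4, d / 2, by linarith, by linarith⟩
  set w : ℝ → ℝ := fun x => (r x - s x ^ 2) * Real.exp (2 * S x) with hw
  set z' : ℝ → ℝ := fun x => P x * Real.exp (-2 * S x) with hz'
  have hz'c : Continuous z' := h.continuous_deriv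
  set η' : ℝ → ℝ := deriv η with hη'
  have hηd : ∀ x, HasDerivAt η (η' x) x := fun x =>
    ((η.contDiff (n := 1)).differentiable (by norm_num)).differentiableAt.hasDerivAt
  have hη'c : Continuous η' := (η.contDiff (n := 1)).continuous_deriv (by norm_num)
  have hηAC : HasACDeriv η η' := .of_contDiff hηd hη'c
  have hηt : ∀ x, x ∉ Set.Icc (x₀ - d / 2) (x₀ + d / 2) → x ∉ tsupport η := by
    intro x hx hm
    rw [η.tsupport_eq, Real.closedBall_eq_Icc] at hm
    exact hx hm
  have hη0 : ∀ x, x ∉ Set.Icc (x₀ - d / 2) (x₀ + d / 2) → η x = 0 := fun x hx =>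
    image_eq_zero_of_notMem_tsupport (hηt x hx)
  have hη'0 : ∀ x, x ∉ Set.Icc (x₀ - d / 2) (x₀ + d / 2) → η' x = 0 := fun x hx =>
    image_eq_zero_of_notMem_tsupport fun hm => hηt x hx (tsupport_deriv_subset hm)
  set k : ℝ → ℝ := fun x => Real.exp (2 * S x) * η' x ^ 2 + w x * η x ^ 2 with hk
  set a := x₀ - d with ha
  -- The form is evaluated at `e^S (ψ₀ + ε η)`, where `ψ₀` is `0` left of `x₀`, `z` on `[x₀, R]`,
  -- and falls linearly from `1` to `0` on `[R, R + N]`. The three resulting terms are the cost of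
  -- the cutoff, the first variation at `x₀`, and the energy of the bump.
  have main : ∀ ε N : ℝ, 0 < N → 0 ≤ Real.exp (2 * B) / N - 2 * ε * P x₀ +
      ε ^ 2 * ((∫ x in a..x₀, k x) + ∫ x in x₀..R, k x) := by
    intro ε N hN
    set h₀ : ℝ → ℝ := fun x => (Set.Ioc x₀ R).indicator z' x +
      (Set.Ioc R (R + N)).indicator (fun _ => -(1 / N)) x with hh₀
    have hh₀i : LocallyIntegrable h₀ := by
      have h1 := (memLp_indicator_Ioc hz'c x₀ R).locallyIntegrable (by norm_num)
      have h2 := (memLp_indicator_Ioc (continuous_const (y := -(1 / N))) R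
        (R + N)).locallyIntegrable (by norm_num)
      exact h1.add h2
    set ψ₀ : ℝ → ℝ := fun x => ∫ t in x₀..x, h₀ t with hψ₀
    have hψ₀AC : HasACDeriv ψ₀ h₀ := .of_locallyIntegrable hh₀i x₀
    have hii := hψ₀AC.intervalIntegrable
    have v1 : ∀ x ≤ x₀, h₀ x = 0 := by
      intro x hx
      have e1 : x ∉ Set.Ioc x₀ R := fun hh => absurd hh.1 (not_lt.2 hx)
      have e2 : x ∉ Set.Ioc R (R + N) := fun hh => absurd hh.1 (not_lt.2 (hx.trans hx₀.le))
      simp [hh₀, e1, e2]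
    have v2 : ∀ x ∈ Set.Ioc x₀ R, h₀ x = z' x := by
      intro x hx
      have e2 : x ∉ Set.Ioc R (R + N) := fun hh => absurd hh.1 (not_lt.2 hx.2)
      simp only [hh₀]
      rw [Set.indicator_of_mem hx, Set.indicator_of_notMem e2, add_zero]
    have v3 : ∀ x ∈ Set.Ioc R (R + N), h₀ x = -(1 / N) := by
      intro x hx
      have e2 : x ∉ Set.Ioc x₀ R := fun hh => absurd hx.1 (not_lt.2 hh.2)
      simp only [hh₀]
      rw [Set.indicator_of_mem hx, Set.indicator_of_notMem e2, zero_add]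
    have v4 : ∀ x, R + N < x → h₀ x = 0 := by
      intro x hx
      have e1 : x ∉ Set.Ioc x₀ R := fun hh => by linarith [hh.2]
      have e2 : x ∉ Set.Ioc R (R + N) := fun hh => by linarith [hh.2]
      simp [hh₀, e1, e2]
    have w1 : ∀ x ≤ x₀, ψ₀ x = 0 := by
      intro x hx
      refine intervalIntegral.integral_zero_ae (.of_forall fun t ht => v1 t ?_)
      rw [Set.uIoc_of_ge hx] at ht
      exact ht.2
    have w2 : ∀ x ∈ Set.Icc x₀ R, ψ₀ x = z x := by
      intro x hx
      have e1 : ψ₀ x = ∫ t in x₀..x, z' t := by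
        refine intervalIntegral.integral_congr_ae (.of_forall fun t ht => v2 t ?_)
        rw [Set.uIoc_of_le hx.1] at ht
        exact ⟨ht.1, ht.2.trans hx.2⟩
      rw [e1, h.hasACDeriv_z.integral_eq_sub, hz0, sub_zero]
    have w3 : ψ₀ (R + N) = 0 := by
      have e1 : ψ₀ (R + N) = ψ₀ R + ∫ t in R..(R + N), h₀ t :=
        (intervalIntegral.integral_add_adjacent_intervals (hii _ _) (hii _ _)).symm
      have e2 : ∫ t in R..(R + N), h₀ t = ∫ t in R..(R + N), -(1 / N) := by
        refine intervalIntegral.integral_congr_ae (.of_forall fun t ht => v3 t ?_)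
        rwa [Set.uIoc_of_le (by linarith)] at ht
      rw [e1, e2, w2 R ⟨hx₀.le, le_rfl⟩, h.z_eq_one R le_rfl, intervalIntegral.integral_const]
      have := hN.ne'
      simp only [smul_eq_mul]
      field_simp
      ring
    have w4 : ∀ x, R + N ≤ x → ψ₀ x = 0 := by
      intro x hx
      have e1 : ψ₀ x = ψ₀ (R + N) + ∫ t in (R + N)..x, h₀ t :=
        (intervalIntegral.integral_add_adjacent_intervals (hii _ _) (hii _ _)).symm
      rw [e1, w3, zero_add]
      refine intervalIntegral.integral_zero_ae (.of_forall fun t ht => v4 t ?_)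
      rw [Set.uIoc_of_le hx] at ht
      exact ht.1
    obtain ⟨hint, hnonneg⟩ := hpos.exp_mul hr hs h.hasACDeriv_S (ψ := fun x => ψ₀ x + ε * η x)
      (h := fun x => h₀ x + ε * η' x) (hψ₀AC.add (hηAC.const_mul ε)) (a := a) (b := R + N)
      (by linarith) (by
        intro x hx
        have e1 : η x = 0 := hη0 x fun hh => hx ⟨by linarith [hh.1], by linarith [hh.2]⟩
        have e2 : ψ₀ x = 0 := by
          rcases le_or_gt x x₀ with hxx | hxx
          · exact w1 x hxx
          · refine w4 x ?_
            by_contra! hh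
            exact hx ⟨by linarith, hh⟩
        simp [e1, e2]) (by
        intro x hx
        have e1 : η' x = 0 := hη'0 x fun hh => hx ⟨by linarith [hh.1], by linarith [hh.2]⟩
        have e2 : h₀ x = 0 := by
          rcases le_or_gt x x₀ with hxx | hxx
          · exact v1 x hxx
          · refine v4 x ?_
            by_contra! hh
            exact hx ⟨by linarith, hh⟩
        simp [e1, e2]) (by
        have m1 := memLp_indicator_Ioc (f := fun x => Real.exp (S x) * z' x) (by fun_prop) x₀ R
        have m2 := memLp_indicator_Ioc (f := fun x => Real.exp (S x) * -(1 / N)) (by fun_prop) R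
          (R + N)
        have m3 : MemLp (fun x => Real.exp (S x) * (ε * η' x)) 2 := by
          refine Continuous.memLp_of_hasCompactSupport (by fun_prop) ?_
          refine HasCompactSupport.intro (isCompact_Icc (a := x₀ - d / 2) (b := x₀ + d / 2))
            fun x hx => ?_
          simp [hη'0 x hx]
        refine ((m1.add m2).add m3).ae_eq (.of_forall fun x => ?_)
        simp only [hh₀, Pi.add_apply, Set.indicator_apply]
        split_ifs <;> ring)
    set b : ℝ → ℝ := fun x => Real.exp (2 * S x) * (h₀ x + ε * η' x) ^ 2 +
      w x * (ψ₀ x + ε * η x) ^ 2 with hb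
    change Integrable b at hint
    change 0 ≤ ∫ x, b x at hnonneg
    have hsplit : ∫ x, b x = (∫ x in a..x₀, b x) + (∫ x in x₀..R, b x) +
        ∫ x in R..(R + N), b x := by
      rw [intervalIntegral.integral_add_adjacent_intervals hint.intervalIntegrable
        hint.intervalIntegrable, intervalIntegral.integral_add_adjacent_intervals
        hint.intervalIntegrable hint.intervalIntegrable]
      refine (intervalIntegral.integral_eq_integral_of_support_subset fun x hx => ?_).symm
      by_contra hxm
      refine hx ?_
      have e1 : x ∉ Set.Icc (x₀ - d / 2) (x₀ + d / 2) := fun hh =>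
        hxm ⟨by linarith [hh.1], by linarith [hh.2]⟩
      have e2 : h₀ x = 0 ∧ ψ₀ x = 0 := by
        rcases le_or_gt x x₀ with hxx | hxx
        · exact ⟨v1 x hxx, w1 x hxx⟩
        · have : R + N < x := by
            by_contra! hh
            exact hxm ⟨by linarith, hh⟩
          exact ⟨v4 x this, w4 x this.le⟩
      simp [hb, hη0 x e1, hη'0 x e1, e2.1, e2.2]
    have hI1 : ∫ x in a..x₀, b x = ε ^ 2 * ∫ x in a..x₀, k x := by
      rw [← intervalIntegral.integral_const_mul]
      refine intervalIntegral.integral_congr_ae (.of_forall fun x hx => ?_)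
      rw [Set.uIoc_of_le (by linarith)] at hx
      simp only [hb, hk, v1 x hx.2, w1 x hx.2]
      ring
    -- Here `w = 0` and the slope is `-1/N`, so the energy is at most `e^{2B} N⁻²` times the length
    -- `N`.
    have hI3 : ∫ x in R..(R + N), b x ≤ Real.exp (2 * B) / N := by
      calc ∫ x in R..(R + N), b x ≤ ∫ x in R..(R + N), Real.exp (2 * B) * (1 / N) ^ 2 := by
            refine intervalIntegral.integral_mono_on_of_le_Ioo (by linarith)
              hint.intervalIntegrable (by simp) fun x hx => ?_
            have e1 : x ∉ Set.Icc (x₀ - d / 2) (x₀ + d / 2) := fun hh => by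
              linarith [hh.2, hx.1]
            simp only [hb, hw, hη'0 x e1, v3 x ⟨hx.1, hx.2.le⟩, hR x hx.1]
            have := hB x hx.1.le
            have : Real.exp (2 * S x) ≤ Real.exp (2 * B) := Real.exp_le_exp.2 (by linarith)
            nlinarith [sq_nonneg (1 / N)]
        _ = Real.exp (2 * B) / N := by
            rw [intervalIntegral.integral_const, smul_eq_mul]
            field_simp
            ring
    -- The terms of order `0` and `1` in `ε` are total derivatives, of `P z` and `2 ε P η`. Since `P
    -- R = 0`, `z x₀ = 0` and `η x₀ = 1`, only `-2 ε P x₀` survives.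
    have hI2 : ∫ x in x₀..R, b x = -2 * ε * P x₀ + ε ^ 2 * ∫ x in x₀..R, k x := by
      have c1 := h.hasACDeriv_P.mul h.hasACDeriv_z
      have c2 := h.hasACDeriv_P.mul hηAC
      have d1 := c1.integral_eq_sub x₀ R
      have d2 := c2.integral_eq_sub x₀ R
      have n1 := c1.intervalIntegrable x₀ R
      have n2 := c2.intervalIntegrable x₀ R
      rw [h.P_eq_zero R le_rfl, hz0, zero_mul, mul_zero, sub_zero] at d1
      rw [h.P_eq_zero R le_rfl, zero_mul, η.one_of_mem_closedBall (Metric.mem_closedBall_self η.rIn_pos.le), mul_one,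
        zero_sub] at d2
      have n3 : IntervalIntegrable k volume x₀ R := by
        have hwi : IntervalIntegrable w volume x₀ R :=
          (((hr.sub hs.integrable_sq).intervalIntegrable).mul_continuousOn
            (g := fun x => Real.exp (2 * S x)) (by fun_prop))
        refine IntervalIntegrable.add (Continuous.intervalIntegrable (by fun_prop) _ _) ?_
        exact hwi.mul_continuousOn (g := fun x => η x ^ 2) (η.continuous.pow 2).continuousOn
      have hcongr : ∫ x in x₀..R, b x = ∫ x in x₀..R,
          (((r x - s x ^ 2) * Real.exp (2 * S x) * z x * z x + P x * (P x * Real.exp (-2 * S x))) +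
          2 * ε * ((r x - s x ^ 2) * Real.exp (2 * S x) * z x * η x + P x * η' x) +
          ε ^ 2 * k x) := by
        refine intervalIntegral.integral_congr_ae (.of_forall fun x hx => ?_)
        rw [Set.uIoc_of_le hx₀.le] at hx
        simp only [hb, hk, hw, v2 x hx, w2 x (Set.Ioc_subset_Icc_self hx), hz']
        linear_combination (P x ^ 2 * Real.exp (-2 * S x) + 2 * ε * η' x * P x) *
          exp_two_mul_exp_neg (S x)
      rw [hcongr, intervalIntegral.integral_add (n1.add (n2.const_mul _)) (n3.const_mul _),
        intervalIntegral.integral_add n1 (n2.const_mul _), intervalIntegral.integral_const_mul,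
        intervalIntegral.integral_const_mul, d1, d2]
      ring
    rw [hsplit, hI1, hI2] at hnonneg
    linarith
  set K := (∫ x in a..x₀, k x) + ∫ x in x₀..R, k x with hK
  have main' : ∀ ε : ℝ, 0 ≤ -2 * ε * P x₀ + ε ^ 2 * K := by
    intro ε
    have hlim : Filter.Tendsto (fun N : ℝ => Real.exp (2 * B) / N - 2 * ε * P x₀ + ε ^ 2 * K)
        .atTop (nhds (0 - 2 * ε * P x₀ + ε ^ 2 * K)) :=
      ((tendsto_const_nhds.div_atTop Filter.tendsto_id).sub_const _).add_const _
    have := ge_of_tendsto hlim (Filter.eventually_atTop.2 ⟨1, fun N hN => main ε N (by linarith)⟩)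
    linarith
  -- After `N → ∞`, the choice `ε = P x₀ / (|K| + 1)` makes the linear term dominate the quadratic
  -- one.
  have hP0 : P x₀ = 0 := by
    by_contra hP
    have hP2 : 0 < P x₀ ^ 2 := by positivity
    have hKp : 0 < |K| + 1 := by positivity
    have := main' (P x₀ / (|K| + 1))
    have e : -2 * (P x₀ / (|K| + 1)) * P x₀ + (P x₀ / (|K| + 1)) ^ 2 * K =
        P x₀ ^ 2 * (K - 2 * (|K| + 1)) / (|K| + 1) ^ 2 := by
      field_simp
      ring
    rw [e] at this
    have neg : P x₀ ^ 2 * (K - 2 * (|K| + 1)) / (|K| + 1) ^ 2 < 0 := by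
      refine div_neg_of_neg_of_pos (mul_neg_of_pos_of_neg hP2 ?_) (by positivity)
      linarith [le_abs_self K, abs_nonneg K]
    linarith
  exact (h.ne_zero x₀).elim (fun h1 => h1 hz0) (fun h1 => h1 hP0)

end IsSolution

/-! ### The Riccati equation -/

/-- The distributions `u' + u²` and `s' + r` agree on real test functions. -/
def RiccatiEq (u r s : ℝ → ℝ) : Prop :=
  ∀ f : ℝ → ℝ, ContDiff ℝ ∞ f → HasCompactSupport f →
    (∫ x, u x ^ 2 * f x) - ∫ x, u x * deriv f x = (∫ x, r x * f x) - ∫ x, s x * deriv f x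

theorem integrable_mul_of_compactSupport {s : ℝ → ℝ} (hs : MemLp s 2) {f : ℝ → ℝ}
    (hf : Continuous f) (hc : HasCompactSupport f) : Integrable fun x => s x * f x :=
  integrable_mul_of_memLp_two hs (hf.memLp_of_hasCompactSupport hc)

theorem integrable_mul_of_compactSupport' {r : ℝ → ℝ} (hr : Integrable r) {f : ℝ → ℝ}
    (hf : Continuous f) (hc : HasCompactSupport f) : Integrable fun x => r x * f x := by
  obtain ⟨K, hK⟩ := hc.exists_bound_of_continuous hf
  exact hr.mul_bdd (c := K) hf.aestronglyMeasurable (.of_forall hK)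

/-- The quotient `v = z'/z` is locally absolutely continuous with `v' = r - s² - 2 s v - v²`, which
rearranges to `v' + (s + v)² = r`. Only `v` is integrated by parts; `s` is never differentiated. -/
theorem IsSolution.riccatiEq {r s S z P : ℝ → ℝ} {R : ℝ} (h : IsSolution r s S z P R)
    (hr : Integrable r) (hs : MemLp s 2) (hz : ∀ x, z x ≠ 0) :
    RiccatiEq (fun x => s x + P x * Real.exp (-2 * S x) * (z x)⁻¹) r s := by
  have hSc := h.hasACDeriv_S.continuous
  have hPc := h.hasACDeriv_P.continuous
  have hzc := h.continuous_z
  set v : ℝ → ℝ := fun x => P x * Real.exp (-2 * S x) * (z x)⁻¹ with hv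
  have hvc : Continuous v := (hPc.mul (by fun_prop)).mul (hzc.inv₀ hz)
  have hE : HasACDeriv (fun x => Real.exp (-2 * S x))
      fun x => -2 * Real.exp (-2 * S x) * s x := by
    refine HasACDeriv.comp_contDiff (H := fun y => Real.exp (-2 * y))
      (h := fun y => -2 * Real.exp (-2 * y)) (fun y => ?_) (by fun_prop) h.hasACDeriv_S
    refine (((hasDerivAt_id y).const_mul (-2)).exp).congr_deriv ?_
    simp
    ring
  have hzi : HasACDeriv (fun x => (z x)⁻¹) fun x => -(P x * Real.exp (-2 * S x)) / z x ^ 2 := by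
    refine .of_contDiff (fun x => (h.hasDerivAt_z x).fun_inv (hz x)) ?_
    exact h.continuous_deriv.neg.div (hzc.pow 2) fun x => pow_ne_zero 2 (hz x)
  have hvAC : HasACDeriv v fun x => r x - s x ^ 2 - 2 * (s x * v x) - v x ^ 2 := by
    refine ((h.hasACDeriv_P.mul hE).mul hzi).congr_deriv (.of_forall fun x => ?_)
    have h1 := mul_inv_cancel₀ (hz x)
    have h2 := exp_two_mul_exp_neg (S x)
    simp only [hv]
    rw [div_eq_mul_inv, ← inv_pow]
    linear_combination (r x - s x ^ 2) * z x * (z x)⁻¹ * h2 + (r x - s x ^ 2) * h1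
  intro f hf hc
  have hfd : ∀ x, HasDerivAt f (deriv f x) x := fun x =>
    (hf.differentiable (by norm_num)).differentiableAt.hasDerivAt
  have hdc : Continuous (deriv f) := hf.continuous_deriv (by norm_num)
  have key := hvAC.integral_mul_add_mul_eq_zero (HasACDeriv.of_contDiff hfd hdc) hc
    fun x hx => image_eq_zero_of_notMem_tsupport fun hm => hx (tsupport_deriv_subset hm)
  have i1 : Integrable fun x => s x ^ 2 * f x :=
    integrable_mul_of_compactSupport' hs.integrable_sq hf.continuous hc
  have i2 : Integrable fun x => s x * (v x * f x) :=
    integrable_mul_of_compactSupport hs (hvc.mul hf.continuous) hc.mul_left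
  have i3 : Integrable fun x => v x ^ 2 * f x :=
    ((hvc.pow 2).mul hf.continuous).integrable_of_hasCompactSupport hc.mul_left
  have i4 : Integrable fun x => v x * deriv f x :=
    (hvc.mul hdc).integrable_of_hasCompactSupport hc.deriv.mul_left
  have i5 : Integrable fun x => r x * f x := integrable_mul_of_compactSupport' hr hf.continuous hc
  have i6 : Integrable fun x => s x * deriv f x :=
    integrable_mul_of_compactSupport hs hdc hc.deriv
  have i7 : Integrable fun x => (s x + v x) ^ 2 * f x := by
    refine ((i1.add (i2.const_mul 2)).add i3).congr (.of_forall fun x => ?_)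
    simp only [Pi.add_apply]
    ring
  have i8 : Integrable fun x => (s x + v x) * deriv f x := by
    refine (i6.add i4).congr (.of_forall fun x => ?_)
    simp only [Pi.add_apply]
    ring
  have i78 : Integrable fun x => (s x + v x) ^ 2 * f x - (s x + v x) * deriv f x := i7.sub i8
  have i56 : Integrable fun x => r x * f x - s x * deriv f x := i5.sub i6
  rw [← sub_eq_zero, ← integral_sub i7 i8, ← integral_sub i5 i6, ← integral_sub i78 i56, ← neg_eq_zero, ← integral_neg, ← key]
  congr 1
  funext x
  ring

/-- A locally square integrable solution of the Riccati equation `u' + u² = s' + r` with `s ∈ L²`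
and `r ∈ L¹` is in `L²`. -/
theorem RiccatiEq.memLp {r s v : ℝ → ℝ} (hv : Continuous v) (hr : Integrable r) (hs : MemLp s 2)
    (h : RiccatiEq (fun x => s x + v x) r s) : MemLp (fun x => s x + v x) 2 := by
  set u : ℝ → ℝ := fun x => s x + v x with hu
  have hum : AEStronglyMeasurable u := hs.aestronglyMeasurable.add hv.aestronglyMeasurable
  let χ : ContDiffBump (0 : ℝ) := ⟨1, 2, by norm_num, by norm_num⟩
  set D := ∫ x, deriv χ x ^ 2 with hD
  have hD0 : 0 ≤ D := integral_nonneg fun x => sq_nonneg _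
  have hux : ∀ χ : ℝ → ℝ, Continuous χ → HasCompactSupport χ → MemLp (fun x => u x * χ x) 2 := by
    intro χ hχ hc
    obtain ⟨K, hK⟩ := hc.exists_bound_of_continuous hχ
    refine ((memLp_mul_of_abs_le hs hχ.aestronglyMeasurable hK).add
      ((hv.mul hχ).memLp_of_hasCompactSupport hc.mul_left)).ae_eq (.of_forall fun x => ?_)
    simp only [hu, Pi.add_apply, Pi.mul_apply]
    ring
  -- Testing with `c²`, `c = χ(x / n)`, gives `∫ u² c² = 2 ∫ u c c' + ∫ r c² - 2 ∫ s c c'`. The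
  -- bound `2 u c c' ≤ u² c² / 2 + 2 c'²` is absorbed on the left, `-2 s c c' ≤ s² + c'²`, and `∫
  -- c'² = D / n ≤ D`. Hence the constant `2 (3 D + ∫ |r| + ∫ s²)`, independent of `n`.
  have main : ∀ n : ℝ, 1 ≤ n → ∫ x in (-n)..n, ‖u x ^ 2‖ ≤
      2 * (3 * D + (∫ x, |r x|) + ∫ x, s x ^ 2) := by
    intro n hn
    have hn0 : 0 < n := by linarith
    set c : ℝ → ℝ := fun x => χ (x / n) with hc
    have hcs : ContDiff ℝ ∞ c := χ.contDiff.comp (contDiff_id.div_const n)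
    have hcc : HasCompactSupport c := by
      refine HasCompactSupport.intro (isCompact_Icc (a := -(2 * n)) (b := 2 * n)) fun x hx => ?_
      refine χ.zero_of_le_dist ?_
      rw [Real.dist_0_eq_abs, abs_div, abs_of_pos hn0, le_div_iff₀ hn0]
      by_contra! hh
      exact hx (abs_le.1 hh.le)
    have hcd : ∀ x, deriv c x = deriv χ (x / n) / n := by
      intro x
      have hχd : HasDerivAt χ (deriv χ (x / n)) (x / n) :=
        ((χ.contDiff (n := 1)).differentiable (by norm_num)).differentiableAt.hasDerivAt
      have := hχd.comp x ((hasDerivAt_id x).div_const n)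
      rw [show c = χ ∘ fun y => id y / n from rfl, this.deriv]
      ring
    have hc0 : ∀ x, 0 ≤ c x := fun x => χ.nonneg
    have hc1 : ∀ x, c x ≤ 1 := fun x => χ.le_one
    have hcm : MemLp (deriv c) 2 :=
      (hcs.continuous_deriv (by norm_num)).memLp_of_hasCompactSupport hcc.deriv
    have hcD : ∫ x, deriv c x ^ 2 ≤ D := by
      simp_rw [hcd, div_pow]
      rw [integral_div, Measure.integral_comp_div (fun x => deriv χ x ^ 2) n, abs_of_pos hn0,
        smul_eq_mul, ← hD]
      rw [div_le_iff₀ (by positivity)]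
      nlinarith [mul_nonneg hD0 hn0.le]
    have hdc2 : ∀ x, deriv (fun y => c y ^ 2) x = 2 * c x * deriv c x := by
      intro x
      have := ((hcs.differentiable (by norm_num)).differentiableAt (x := x)).hasDerivAt.pow 2
      refine this.deriv.trans ?_
      simp
    have key := h (fun x => c x ^ 2) (hcs.pow 2)
      (hcc.comp_left (g := fun t : ℝ => t ^ 2) (by simp))
    simp only [hdc2] at key
    have m1 := hux c hcs.continuous hcc
    have m2 := memLp_mul_of_abs_le hs hcs.continuous.aestronglyMeasurable
      (K := 1) fun x => by rw [abs_of_nonneg (hc0 x)]; exact hc1 x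
    have e1 : ∫ x, u x ^ 2 * c x ^ 2 = ∫ x, (u x * c x) ^ 2 := by simp_rw [mul_pow]
    have e2 : ∫ x, u x * (2 * c x * deriv c x) ≤
        ∫ x, ((1 / 2) * (u x * c x) ^ 2 + 2 * deriv c x ^ 2) := by
      refine integral_mono ?_ ((m1.integrable_sq.const_mul _).add
        (hcm.integrable_sq.const_mul _)) fun x => ?_
      · refine ((integrable_mul_of_memLp_two m1 hcm).const_mul 2).congr (.of_forall fun x => ?_)
        ring
      · nlinarith [sq_nonneg (u x * c x - 2 * deriv c x)]
    have e3 : -∫ x, s x * (2 * c x * deriv c x) ≤ ∫ x, (s x ^ 2 + deriv c x ^ 2) := by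
      rw [← integral_neg]
      refine integral_mono ?_ (hs.integrable_sq.add hcm.integrable_sq) fun x => ?_
      · refine ((integrable_mul_of_memLp_two m2 hcm).const_mul (-2)).congr
          (.of_forall fun x => ?_)
        ring
      · have h2 : (s x * c x) ^ 2 ≤ s x ^ 2 := by
          rw [mul_pow]
          exact mul_le_of_le_one_right (sq_nonneg _) (pow_le_one₀ (hc0 x) (hc1 x))
        nlinarith [sq_nonneg (s x * c x + deriv c x)]
    have e4 : ∫ x, r x * c x ^ 2 ≤ ∫ x, |r x| := by
      refine integral_mono (integrable_mul_of_compactSupport' hr (hcs.pow 2).continuous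
        (hcc.comp_left (g := fun t : ℝ => t ^ 2) (by simp))) hr.abs fun x => ?_
      have h2 := pow_le_one₀ (n := 2) (hc0 x) (hc1 x)
      have h3 := sq_nonneg (c x)
      calc r x * c x ^ 2 ≤ |r x| * c x ^ 2 := by gcongr; exact le_abs_self _
        _ ≤ |r x| := mul_le_of_le_one_right (abs_nonneg _) h2
    rw [integral_add (m1.integrable_sq.const_mul _) (hcm.integrable_sq.const_mul _),
      integral_const_mul, integral_const_mul] at e2
    rw [integral_add hs.integrable_sq hcm.integrable_sq] at e3
    have e5 : ∫ x in (-n)..n, ‖u x ^ 2‖ ≤ ∫ x, (u x * c x) ^ 2 := by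
      rw [intervalIntegral.integral_of_le (by linarith)]
      calc ∫ x in Set.Ioc (-n) n, ‖u x ^ 2‖ = ∫ x in Set.Ioc (-n) n, (u x * c x) ^ 2 := by
            refine setIntegral_congr_fun measurableSet_Ioc fun x hx => ?_
            have : c x = 1 := by
              refine χ.one_of_mem_closedBall ?_
              rw [mem_closedBall_zero_iff, Real.norm_eq_abs, abs_div, abs_of_pos hn0]
              change |x| / n ≤ 1
              rw [div_le_one hn0, abs_le]
              exact ⟨hx.1.le, hx.2⟩
            simp [this]
        _ ≤ ∫ x, (u x * c x) ^ 2 :=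
            setIntegral_le_integral m1.integrable_sq (.of_forall fun x => sq_nonneg _)
    rw [e1] at key
    linarith
  refine (memLp_two_iff_integrable_sq hum).2 ?_
  refine integrable_of_intervalIntegral_norm_bounded (l := .atTop) (a := fun n : ℕ => -(n : ℝ))
    (b := fun n : ℕ => (n : ℝ)) _ (fun n => ?_)
    (Filter.tendsto_neg_atTop_atBot.comp tendsto_natCast_atTop_atTop) tendsto_natCast_atTop_atTop
    (Filter.eventually_atTop.2 ⟨1, fun n hn => main n (by exact_mod_cast hn)⟩)
  have hvr : MemLp v 2 (volume.restrict (Set.Ioc (-(n : ℝ)) n)) :=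
    (memLp_indicator_iff_restrict measurableSet_Ioc).1 (memLp_indicator_Ioc hv _ _)
  exact ((hs.restrict _).add hvr).integrable_sq

/-- If the operator `-d²/dx² + (s' + r)` is nonnegative and its potential has a Riccati
representative that is integrable near `+∞`, then it has such a representative globally. -/
theorem exists_riccatiEq {r s : ℝ → ℝ} {R : ℝ} (hr : Integrable r) (hs : MemLp s 2) (hR0 : 0 ≤ R)
    (hR : ∀ x, R < x → r x = s x ^ 2) (hsi : IntegrableOn s (Set.Ioi 0)) (hpos : FormNonneg r s) :
    ∃ u, MemLp u 2 ∧ IntegrableOn u (Set.Ioi 0) ∧ RiccatiEq u r s := by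
  have hsl : LocallyIntegrable s := hs.locallyIntegrable (by norm_num)
  have hS := HasACDeriv.of_locallyIntegrable hsl R
  obtain ⟨z, P, h⟩ := exists_isSolution hS (hr.sub hs.integrable_sq).locallyIntegrable hR
  have hz := h.z_ne_zero hr hs hpos hR (B := ∫ x in Set.Ioi 0, |s x|) fun x hx => by
    rw [intervalIntegral.integral_of_le hx]
    calc ∫ t in Set.Ioc R x, s t ≤ ∫ t in Set.Ioc R x, |s t| := by
          refine integral_mono_ae ?_ ?_ (.of_forall fun t => le_abs_self _)
          · exact hsi.mono_set fun t ht => hR0.trans_lt ht.1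
          · exact (hsi.mono_set fun t ht => hR0.trans_lt ht.1).abs
      _ ≤ ∫ t in Set.Ioi 0, |s t| := by
          refine setIntegral_mono_set hsi.abs (.of_forall fun t => abs_nonneg _) ?_
          exact (show Set.Ioc R x ⊆ Set.Ioi 0 from fun t ht => hR0.trans_lt ht.1).eventuallyLE
  have hric := h.riccatiEq hr hs hz
  have hvc : Continuous fun x => P x * Real.exp (-2 * ∫ t in R..x, s t) * (z x)⁻¹ :=
    h.continuous_deriv.mul (h.continuous_z.inv₀ hz)
  -- Integrability on `(0, ∞)` is inherited from `s`: the correction `z'/z` is continuous on `[0,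
  -- R]` and zero beyond `R`.
  refine ⟨_, RiccatiEq.memLp hvc hr hs hric, hsi.add ?_, hric⟩
  have h1 := hvc.integrableOn_Icc (a := 0) (b := R) (μ := volume)
  have h2 : IntegrableOn (fun x => P x * Real.exp (-2 * ∫ t in R..x, s t) * (z x)⁻¹)
      (Set.Ioi R) := by
    refine (integrableOn_zero (s := Set.Ioi R)).congr_fun (fun x hx => ?_) measurableSet_Ioi
    simp [h.P_eq_zero x (le_of_lt hx)]
  exact (h1.union h2).mono_set fun x hx => by
    rcases le_or_gt x R with hxR | hxR
    · exact .inl ⟨le_of_lt hx, hxR⟩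
    · exact .inr hxR

/-! ### Reflection to the left half-line -/

theorem deriv_comp_neg_apply (f : ℝ → ℝ) (x : ℝ) : deriv (fun y => f (-y)) x = -deriv f (-x) :=
  deriv_comp_neg f x

theorem FormNonneg.comp_neg {r s : ℝ → ℝ} (h : FormNonneg r s) :
    FormNonneg (fun x => r (-x)) (fun x => -s (-x)) := by
  intro φ hφ hc
  have h1 := h (fun x => φ (-x)) (hφ.comp contDiff_neg) (hc.comp_homeomorph (Homeomorph.neg ℝ))
  simp only [deriv_comp_neg_apply] at h1
  convert h1 using 1
  rw [← integral_neg_eq_self (fun x => deriv φ x ^ 2),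
    ← integral_neg_eq_self (fun x => r (-x) * φ x ^ 2),
    ← integral_neg_eq_self (fun x => -s (-x) * (2 * φ x * deriv φ x))]
  simp

theorem RiccatiEq.comp_neg {u r s : ℝ → ℝ} (h : RiccatiEq u r s) :
    RiccatiEq (fun x => -u (-x)) (fun x => r (-x)) (fun x => -s (-x)) := by
  intro f hf hc
  have h1 := h (fun x => f (-x)) (hf.comp contDiff_neg) (hc.comp_homeomorph (Homeomorph.neg ℝ))
  simp only [deriv_comp_neg_apply] at h1
  rw [← integral_neg_eq_self (fun x => (-u (-x)) ^ 2 * f x),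
    ← integral_neg_eq_self (fun x => -u (-x) * deriv f x),
    ← integral_neg_eq_self (fun x => r (-x) * f x),
    ← integral_neg_eq_self (fun x => -s (-x) * deriv f x)]
  simpa using h1

theorem exists_riccatiEq_left {r s : ℝ → ℝ} {R : ℝ} (hr : Integrable r) (hs : MemLp s 2)
    (hR0 : 0 ≤ R) (hR : ∀ x, x < -R → r x = s x ^ 2) (hsi : IntegrableOn s (Set.Iio 0))
    (hpos : FormNonneg r s) :
    ∃ u, MemLp u 2 ∧ IntegrableOn u (Set.Iio 0) ∧ RiccatiEq u r s := by
  obtain ⟨u, hu, hui, hric⟩ := exists_riccatiEq (R := R) hr.comp_neg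
    (hs.comp_measurePreserving (Measure.measurePreserving_neg volume)).neg hR0
    (fun x hx => by simpa using hR (-x) (by linarith))
    (by
      have := hsi.comp_neg
      simpa [Function.comp_def] using this.neg) hpos.comp_neg
  refine ⟨fun x => -u (-x), (hu.comp_measurePreserving (Measure.measurePreserving_neg volume)).neg,
    ?_, ?_⟩
  · have := hui.comp_neg
    simpa using this.neg
  · simpa using hric.comp_neg

end Miura

/-! ### Distributions `s' + r` and the space `H⁻¹` -/

noncomputable section

namespace Miura

open FourierTransform LineDeriv

/-- An integrable function as a distribution. -/
def ofL1 (r : ℝ → ℝ) (hr : Integrable r) : 𝓢'(ℝ, ℂ) :=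
  (((memLp_one_iff_integrable.2 hr).ofReal (K := ℂ)).toLp : Lp ℂ 1 (volume : Measure ℝ))

theorem ofL1_apply (r : ℝ → ℝ) (hr : Integrable r) (f : 𝓢(ℝ, ℂ)) :
    ofL1 r hr f = ∫ x, (r x : ℂ) * f x := by
  rw [ofL1, Lp.toTemperedDistribution_apply]
  refine integral_congr_ae ?_
  filter_upwards [((memLp_one_iff_integrable.2 hr).ofReal (K := ℂ)).coeFn_toLp] with x hx
  rw [hx]
  simp [mul_comm]

/-- The potential `s' + r` for `s ∈ L²` and `r ∈ L¹`. -/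
def potential (r s : ℝ → ℝ) (hr : Integrable r) (hs : MemLp s 2) : 𝓢'(ℝ, ℂ) :=
  derivCLM ℂ (ofL2 s hs) + ofL1 r hr

theorem potential_apply (r s : ℝ → ℝ) (hr : Integrable r) (hs : MemLp s 2) (f : 𝓢(ℝ, ℂ)) :
    potential r s hr hs f = (∫ x, (r x : ℂ) * f x) - ∫ x, (s x : ℂ) * deriv f x := by
  have h1 : ofL2 s hs (-SchwartzMap.derivCLM ℂ ℂ f) = -∫ x, (s x : ℂ) * deriv f x := by
    rw [ofL2, Lp.toTemperedDistribution_apply, ← integral_neg]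
    refine integral_congr_ae ?_
    filter_upwards [(hs.ofReal (K := ℂ)).coeFn_toLp] with x hx
    rw [hx]
    simp [mul_comm]
  change ofL2 s hs (-SchwartzMap.derivCLM ℂ ℂ f) + ofL1 r hr f = _
  rw [h1, ofL1_apply]
  ring

theorem miura_eq_potential (u : ℝ → ℝ) (hu : MemLp u 2) :
    miura u hu = potential (fun x => u x ^ 2) u hu.integrable_sq hu := by
  ext f
  rw [miura_apply, potential_apply]

theorem isRealDist_potential (r s : ℝ → ℝ) (hr : Integrable r) (hs : MemLp s 2) :
    IsRealDist (potential r s hr hs) := by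
  intro f hf
  have hre : ∀ x, f x = ((f x).re : ℂ) := fun x => Complex.ext rfl (by simp [hf x])
  have hd : ∀ x, (deriv f x).im = 0 := by
    intro x
    have h1 := (Complex.imCLM.hasFDerivAt.comp_hasDerivAt x (f.hasDerivAt x)).deriv
    have h2 : (Complex.imCLM ∘ f : ℝ → ℝ) = fun _ => 0 := funext fun x => hf x
    change deriv (Complex.imCLM ∘ f) x = (deriv f x).im at h1
    rw [← h1, h2]
    simp
  have hre' : ∀ x, deriv f x = ((deriv f x).re : ℂ) := fun x => Complex.ext rfl (by simp [hd x])
  rw [potential_apply]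
  have e1 : ∫ x, (r x : ℂ) * f x = ((∫ x, r x * (f x).re : ℝ) : ℂ) := by
    rw [← integral_complex_ofReal]
    congr 1
    funext x
    rw [hre x]
    push_cast
    simp
  have e2 : ∫ x, (s x : ℂ) * deriv f x = ((∫ x, s x * (deriv f x).re : ℝ) : ℂ) := by
    rw [← integral_complex_ofReal]
    congr 1
    funext x
    rw [hre' x]
    push_cast
    simp
  rw [e1, e2, ← Complex.ofReal_sub, Complex.ofReal_im]

theorem memLp_two_besselWeight :
    MemLp (fun x : ℝ => (((1 + ‖x‖ ^ 2) ^ ((-1 : ℝ) / 2) : ℝ) : ℂ)) 2 := by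
  have hpos : ∀ x : ℝ, 0 < 1 + ‖x‖ ^ 2 := fun x => by positivity
  have hc : Continuous fun x : ℝ => (1 + ‖x‖ ^ 2) ^ ((-1 : ℝ) / 2) :=
    Continuous.rpow_const (by fun_prop) fun x => .inl (hpos x).ne'
  refine MemLp.ofReal ((memLp_two_iff_integrable_sq hc.aestronglyMeasurable).2 ?_)
  refine integrable_inv_one_add_sq.congr (.of_forall fun x => ?_)
  change (1 + x ^ 2)⁻¹ = ((1 + ‖x‖ ^ 2) ^ ((-1 : ℝ) / 2)) ^ 2
  rw [← Real.rpow_natCast ((1 + ‖x‖ ^ 2) ^ ((-1 : ℝ) / 2)), ← Real.rpow_mul (hpos x).le]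
  norm_num [Real.rpow_neg_one]

theorem integral_fourier_mul_eq {f g : ℝ → ℂ} (hf : Integrable f) (hg : Integrable g) :
    ∫ x, 𝓕 f x * g x = ∫ x, f x * 𝓕 g x := by
  have := VectorFourier.integral_fourierIntegral_smul_eq_flip (μ := volume) (ν := volume)
    (L := innerₗ ℝ) Real.continuous_fourierChar continuous_inner hf hg
  rw [flip_innerₗ] at this
  exact this

/-- The Fourier transform of an `L¹` function is bounded and continuous, and in dimension one the
weight `(1 + ξ²)^{-1/2}` is square integrable. -/
theorem memSobolev_of_Lp_one (g : Lp ℂ 1 (volume : Measure ℝ)) :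
    MemSobolev (-1) 2 (g : 𝓢'(ℝ, ℂ)) := by
  rw [memSobolev_iff_exists_smulLeftCLM_fourier]
  set m : ℝ → ℂ := fun x => (((1 + ‖x‖ ^ 2) ^ ((-1 : ℝ) / 2) : ℝ) : ℂ) with hm
  have hmt : m.HasTemperateGrowth := by
    simp only [hm]
    fun_prop
  have hgi : Integrable g := L1.integrable_coeFn g
  have hbd : ∀ x, ‖𝓕 (g : ℝ → ℂ) x‖ ≤ ∫ x, ‖g x‖ := fun x =>
    VectorFourier.norm_fourierIntegral_le_integral_norm _ _ _ _ _
  have hcont : Continuous (𝓕 (g : ℝ → ℂ)) :=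
    VectorFourier.fourierIntegral_continuous Real.continuous_fourierChar continuous_inner hgi
  have hG : MemLp (fun x => m x * 𝓕 (g : ℝ → ℂ) x) 2 := by
    refine memLp_two_besselWeight.of_le_mul (c := ∫ x, ‖g x‖)
      (memLp_two_besselWeight.aestronglyMeasurable.mul hcont.aestronglyMeasurable)
      (.of_forall fun x => ?_)
    rw [norm_mul, mul_comm]
    exact mul_le_mul_of_nonneg_right (hbd x) (norm_nonneg _)
  refine ⟨hG.toLp, ?_⟩
  ext ψ
  rw [smulLeftCLM_apply_apply, TemperedDistribution.fourier_apply, Lp.toTemperedDistribution_apply,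
    Lp.toTemperedDistribution_apply]
  have h1 := integral_fourier_mul_eq (SchwartzMap.integrable
    (SchwartzMap.smulLeftCLM ℂ m ψ) (μ := volume)) hgi
  simp only [smul_eq_mul, SchwartzMap.fourier_coe]
  refine h1.trans (integral_congr_ae ?_)
  filter_upwards [hG.coeFn_toLp] with x hx
  rw [hx, SchwartzMap.smulLeftCLM_apply_apply hmt, smul_eq_mul]
  ring

theorem memSobolev_derivCLM {q : 𝓢'(ℝ, ℂ)} (hq : MemSobolev 0 2 q) :
    MemSobolev (-1) 2 (derivCLM ℂ q) := by
  have h := hq.lineDerivOp (m := (1 : ℝ))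
  rw [zero_sub] at h
  have hd : derivCLM ℂ q = ∂_{(1 : ℝ)} q := rfl
  rw [hd]
  exact h

theorem memSobolev_potential (r s : ℝ → ℝ) (hr : Integrable r) (hs : MemLp s 2) :
    MemSobolev (-1) 2 (potential r s hr hs) :=
  (memSobolev_derivCLM (memSobolev_zero_iff.2 ⟨_, rfl⟩)).add (memSobolev_of_Lp_one _)

/-- Elements of `H⁻¹(ℝ)` are of the form `h₀ + h₁'` with `h₀, h₁ ∈ L²`. -/
theorem exists_eq_add_deriv {q : 𝓢'(ℝ, ℂ)} (hq : MemSobolev (-1) 2 q) :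
    ∃ h₀ h₁ : Lp ℂ 2 (volume : Measure ℝ), ∀ f : 𝓢(ℝ, ℂ),
      q f = (∫ x, f x * h₀ x) + ∫ x, deriv f x * h₁ x := by
  -- `G ∈ H¹` solves `q = G + M G`, where `M` has symbol `ξ²`. With the Fourier normalisation in
  -- force, `G'' = -(2π)² M G`, so `h₀ = G` and `h₁ = (2π)⁻² G'`, the sign being absorbed by the
  -- transposed derivative.
  set G := besselPotential ℝ ℂ (-2) q with hG
  have hqG : q = besselPotential ℝ ℂ 2 G := by simp [hG]
  have hG1 : MemSobolev 1 2 G := by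
    rw [hG, memSobolev_besselPotential_iff]
    convert hq using 1
    norm_num
  obtain ⟨g₀, hg₀⟩ := memSobolev_zero_iff.1 (hG1.mono (s' := 0) (by norm_num))
  have hd := hG1.lineDerivOp (m := (1 : ℝ))
  rw [sub_self] at hd
  obtain ⟨g₁, hg₁⟩ := memSobolev_zero_iff.1 hd
  set w : ℝ → ℂ := (fun x : ℝ => ((inner ℝ x (1 : ℝ) : ℝ) : ℂ)) *
    fun x : ℝ => ((inner ℝ x (1 : ℝ) : ℝ) : ℂ) with hw
  have hwt : w.HasTemperateGrowth := by
    rw [hw]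
    fun_prop
  have hM : q = G + fourierMultiplierCLM ℂ w G := by
    have hb : (fun x : ℝ => (((1 + ‖x‖ ^ 2) ^ ((2 : ℝ) / 2) : ℝ) : ℂ)) =
        (fun _ => (1 : ℂ)) + w := by
      funext x
      simp [hw]
      norm_cast
      ring
    ext f
    rw [hqG, besselPotential, hb]
    change _ = G f + fourierMultiplierCLM ℂ w G f
    rw [fourierMultiplierCLM_apply_apply, fourierMultiplierCLM_apply_apply,
      SchwartzMap.smulLeftCLM_add (by fun_prop) hwt]
    simp
  have hdd : ∂_{(1 : ℝ)} (∂_{(1 : ℝ)} G) = (-(2 * Real.pi) ^ 2 : ℂ) • fourierMultiplierCLM ℂ w G := by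
    rw [lineDeriv_eq_fourierMultiplierCLM (1 : ℝ) (∂_{(1 : ℝ)} G),
      lineDeriv_eq_fourierMultiplierCLM (1 : ℝ) G, ContinuousLinearMap.map_smul,
      fourierMultiplierCLM_fourierMultiplierCLM_apply (by fun_prop) (by fun_prop), smul_smul]
    congr 1
    linear_combination (2 * Real.pi) ^ 2 * Complex.I_sq
  have hpi : (Real.pi : ℂ) ≠ 0 := by exact_mod_cast Real.pi_ne_zero
  refine ⟨g₀, ((2 * Real.pi : ℂ) ^ 2)⁻¹ • g₁, fun f => ?_⟩
  have e1 : G f = ∫ x, f x * g₀ x := by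
    rw [hg₀, Lp.toTemperedDistribution_apply]
    rfl
  have e2 : (∂_{(1 : ℝ)} (∂_{(1 : ℝ)} G) : 𝓢'(ℝ, ℂ)) f = -∫ x, deriv f x * g₁ x := by
    rw [lineDerivOp_apply_apply, hg₁, map_neg, Lp.toTemperedDistribution_apply]
    rfl
  have e3 : (∂_{(1 : ℝ)} (∂_{(1 : ℝ)} G) : 𝓢'(ℝ, ℂ)) f =
      -(2 * Real.pi) ^ 2 * fourierMultiplierCLM ℂ w G f := by
    rw [hdd]
    rfl
  have e4 : q f = G f + fourierMultiplierCLM ℂ w G f := by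
    nth_rw 1 [hM]
    rfl
  have e5 : ∫ x, deriv f x * (((2 * Real.pi : ℂ) ^ 2)⁻¹ • g₁ : Lp ℂ 2 (volume : Measure ℝ)) x =
      ((2 * Real.pi : ℂ) ^ 2)⁻¹ * ∫ x, deriv f x * g₁ x := by
    rw [← integral_const_mul]
    refine integral_congr_ae ?_
    filter_upwards [Lp.coeFn_smul ((2 * Real.pi : ℂ) ^ 2)⁻¹ g₁] with x hx
    rw [hx, Pi.smul_apply, smul_eq_mul]
    ring
  rw [e4, e5, ← e1]
  rw [e2] at e3
  have e6 : ∫ x, deriv f x * g₁ x = (2 * Real.pi) ^ 2 * fourierMultiplierCLM ℂ w G f := by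
    linear_combination -e3
  rw [e6, inv_mul_cancel_left₀ (by simp [hpi])]

/-! ### Real test functions and their density -/

/-- A real function of `C₀^∞(ℝ)` as a complex test function. -/
def realTest (f : ℝ → ℝ) (hf : ContDiff ℝ ∞ f) (hc : HasCompactSupport f) : 𝓢(ℝ, ℂ) :=
  (hc.comp_left (g := fun t : ℝ => (t : ℂ)) (by simp)).toSchwartzMap
    (Complex.ofRealCLM.contDiff.comp hf)

@[simp]
theorem realTest_apply (f : ℝ → ℝ) (hf : ContDiff ℝ ∞ f) (hc : HasCompactSupport f) (x : ℝ) :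
    realTest f hf hc x = f x := rfl

@[simp]
theorem deriv_realTest (f : ℝ → ℝ) (hf : ContDiff ℝ ∞ f) (hc : HasCompactSupport f) (x : ℝ) :
    deriv (realTest f hf hc) x = deriv f x :=
  ((hf.differentiable (by norm_num)).differentiableAt.hasDerivAt.ofReal_comp (f := f)
    (u := deriv f x)).deriv

theorem hasCompactSupport_re {f : ℝ → ℂ} (hc : HasCompactSupport f) :
    HasCompactSupport fun x => (f x).re :=
  hc.comp_left (g := Complex.re) (by simp)

theorem hasCompactSupport_im {f : ℝ → ℂ} (hc : HasCompactSupport f) :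
    HasCompactSupport fun x => (f x).im :=
  hc.comp_left (g := Complex.im) (by simp)

theorem eq_zero_of_realTest {q : 𝓢'(ℝ, ℂ)}
    (h : ∀ f hf hc, q (realTest f hf hc) = 0) (f : 𝓢(ℝ, ℂ)) (hc : HasCompactSupport f) :
    q f = 0 := by
  have hfs : ContDiff ℝ ∞ f := f.smooth ⊤
  have hre : ContDiff ℝ ∞ fun x => (f x).re := Complex.reCLM.contDiff.comp hfs
  have him : ContDiff ℝ ∞ fun x => (f x).im := Complex.imCLM.contDiff.comp hfs
  have hf : f = realTest _ hre (hasCompactSupport_re hc) +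
      Complex.I • realTest _ him (hasCompactSupport_im hc) := by
    ext x
    change f x = ((f x).re : ℂ) + Complex.I * ((f x).im : ℂ)
    rw [mul_comm, Complex.re_add_im]
  rw [hf, map_add, map_smul, h, h, smul_zero, add_zero]

theorem integrable_schwartz_mul (f : 𝓢(ℝ, ℂ)) (h : Lp ℂ 2 (volume : Measure ℝ)) :
    Integrable fun x => f x * h x :=
  (f.memLp 2 volume).integrable_mul (Lp.memLp h)

theorem integrable_deriv_schwartz_mul (f : 𝓢(ℝ, ℂ)) (h : Lp ℂ 2 (volume : Measure ℝ)) :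
    Integrable fun x => deriv f x * h x :=
  integrable_schwartz_mul (SchwartzMap.derivCLM ℂ ℂ f) h

/-- Elements of `H⁻¹(ℝ)` are determined by their values on real functions of `C₀^∞(ℝ)`. -/
theorem eq_zero_of_memSobolev {q : 𝓢'(ℝ, ℂ)} (hq : MemSobolev (-1) 2 q)
    (h : ∀ f hf hc, q (realTest f hf hc) = 0) : q = 0 := by
  obtain ⟨h₀, h₁, hrep⟩ := exists_eq_add_deriv hq
  ext f
  change q f = 0
  let χ : ContDiffBump (0 : ℝ) := ⟨1, 2, by norm_num, by norm_num⟩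
  have hχs : ContDiff ℝ ∞ χ := χ.contDiff
  have hχd : ∀ x, HasDerivAt χ (deriv χ x) x := fun x =>
    (hχs.differentiable (by norm_num)).differentiableAt.hasDerivAt
  obtain ⟨C, hC⟩ := (χ.hasCompactSupport.deriv).exists_bound_of_continuous
    (hχs.continuous_deriv (by norm_num))
  have hC0 : 0 ≤ C := (norm_nonneg _).trans (hC 0)
  -- A Schwartz function is approached by its truncations `c n * f`. In the representation by `h₀`
  -- and `h₁`, dominated convergence carries the vanishing of `q` from the truncations to `f`.
  set c : ℕ → ℝ → ℝ := fun n x => χ (x / (n + 1)) with hc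
  have hcd : ∀ n x, HasDerivAt (c n) (deriv χ (x / (n + 1)) / (n + 1)) x := by
    intro n x
    have := (hχd (x / (n + 1))).comp x ((hasDerivAt_id x).div_const ((n : ℝ) + 1))
    exact this.congr_deriv (by ring)
  have hcs : ∀ n, ContDiff ℝ ∞ (c n) := fun n => hχs.comp (contDiff_id.div_const _)
  have hcc : ∀ n, HasCompactSupport (c n) := by
    intro n
    refine HasCompactSupport.intro (isCompact_Icc (a := -(2 * ((n : ℝ) + 1)))
      (b := 2 * ((n : ℝ) + 1))) fun x hx => ?_
    refine χ.zero_of_le_dist ?_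
    have hn0 : (0 : ℝ) < n + 1 := by positivity
    rw [Real.dist_0_eq_abs, abs_div, abs_of_pos hn0, le_div_iff₀ hn0]
    by_contra! hh
    exact hx (abs_le.1 hh.le)
  have hc1 : ∀ n x, |c n x| ≤ 1 := fun n x => by
    rw [abs_of_nonneg χ.nonneg]
    exact χ.le_one
  have hcf : ∀ n, HasCompactSupport fun x => (c n x : ℂ) * f x := fun n =>
    ((hcc n).comp_left (g := fun t : ℝ => (t : ℂ)) (by simp)).mul_right
  have hcfs : ∀ n, ContDiff ℝ ∞ fun x => (c n x : ℂ) * f x := fun n =>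
    (Complex.ofRealCLM.contDiff.comp (hcs n)).mul (f.smooth ⊤)
  set F : ℕ → 𝓢(ℝ, ℂ) := fun n => (hcf n).toSchwartzMap (hcfs n) with hF
  have hFapp : ∀ n x, F n x = (c n x : ℂ) * f x := fun n x => rfl
  have hFd : ∀ n x, deriv (F n) x =
      ((deriv χ (x / (n + 1)) / (n + 1) : ℝ) : ℂ) * f x + (c n x : ℂ) * deriv f x := by
    intro n x
    exact ((hcd n x).ofReal_comp.mul (f.hasDerivAt x)).deriv
  have hF0 : ∀ n, q (F n) = 0 := fun n => eq_zero_of_realTest h (F n) (hcf n)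
  have hclim : ∀ x, Filter.Tendsto (fun n : ℕ => x / ((n : ℝ) + 1)) .atTop (nhds 0) := by
    intro x
    have := (tendsto_one_div_add_atTop_nhds_zero_nat (𝕜 := ℝ)).const_mul x
    simpa [div_eq_mul_inv] using this
  have hc1lim : ∀ x, Filter.Tendsto (fun n : ℕ => (c n x : ℂ)) .atTop (nhds 1) := by
    intro x
    have h1 := (χ.continuous.tendsto 0).comp (hclim x)
    rw [χ.one_of_mem_closedBall (Metric.mem_closedBall_self χ.rIn_pos.le)] at h1
    simpa using! (Complex.continuous_ofReal.tendsto _).comp h1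
  have hc2lim : ∀ x, Filter.Tendsto
      (fun n : ℕ => ((deriv χ (x / (n + 1)) / (n + 1) : ℝ) : ℂ)) .atTop (nhds 0) := by
    intro x
    rw [tendsto_zero_iff_norm_tendsto_zero]
    refine squeeze_zero (fun n => norm_nonneg _) (fun n => ?_) (hclim C)
    have hn0 : (0 : ℝ) < n + 1 := by positivity
    rw [Complex.norm_real, norm_div, Real.norm_of_nonneg hn0.le]
    gcongr
    exact hC _
  have L0 : Filter.Tendsto (fun n => ∫ x, F n x * h₀ x) .atTop (nhds (∫ x, f x * h₀ x)) := by
    refine tendsto_integral_of_dominated_convergence (fun x => ‖f x * h₀ x‖)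
      (fun n => (integrable_schwartz_mul (F n) h₀).aestronglyMeasurable)
      (integrable_schwartz_mul f h₀).norm (fun n => .of_forall fun x => ?_)
      (.of_forall fun x => ?_)
    · rw [hFapp, mul_assoc, norm_mul, Complex.norm_real]
      exact mul_le_of_le_one_left (norm_nonneg _) (hc1 n x)
    · simp_rw [hFapp]
      simpa using ((hc1lim x).mul_const (f x)).mul_const (h₀ x)
  have L1 : Filter.Tendsto (fun n => ∫ x, deriv (F n) x * h₁ x) .atTop
      (nhds (∫ x, deriv f x * h₁ x)) := by
    refine tendsto_integral_of_dominated_convergence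
      (fun x => C * ‖f x * h₁ x‖ + ‖deriv f x * h₁ x‖)
      (fun n => (integrable_deriv_schwartz_mul (F n) h₁).aestronglyMeasurable)
      (((integrable_schwartz_mul f h₁).norm.const_mul C).add
        (integrable_deriv_schwartz_mul f h₁).norm) (fun n => .of_forall fun x => ?_)
      (.of_forall fun x => ?_)
    · rw [hFd, add_mul, mul_assoc, mul_assoc]
      refine (norm_add_le _ _).trans (add_le_add ?_ ?_)
      · rw [norm_mul, Complex.norm_real, norm_div]
        refine mul_le_mul_of_nonneg_right ?_ (norm_nonneg _)
        have hn0 : (1 : ℝ) ≤ n + 1 := by simp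
        rw [Real.norm_of_nonneg (r := (n : ℝ) + 1) (by positivity), div_le_iff₀ (by positivity)]
        have := hC (x / (n + 1))
        nlinarith
      · rw [norm_mul, Complex.norm_real]
        exact mul_le_of_le_one_left (norm_nonneg _) (hc1 n x)
    · simp_rw [hFd]
      simpa using ((((hc2lim x).mul_const (f x))).add
        ((hc1lim x).mul_const (deriv f x))).mul_const (h₁ x)
  have hlim := L0.add L1
  simp_rw [← hrep, hF0] at hlim
  exact tendsto_nhds_unique hlim tendsto_const_nhds

theorem ext_of_memSobolev {q q' : 𝓢'(ℝ, ℂ)} (hq : MemSobolev (-1) 2 q)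
    (hq' : MemSobolev (-1) 2 q')
    (h : ∀ f hf hc, q (realTest f hf hc) = q' (realTest f hf hc)) : q = q' := by
  refine sub_eq_zero.1 (eq_zero_of_memSobolev (hq.sub hq') fun f hf hc => ?_)
  change q _ - q' _ = 0
  rw [h, sub_self]

/-- `q = s' + r` on real test functions. -/
def Represents (q : 𝓢'(ℝ, ℂ)) (r s : ℝ → ℝ) : Prop :=
  ∀ f hf hc, q (realTest f hf hc) =
    (((∫ x, r x * f x) - ∫ x, s x * deriv f x : ℝ) : ℂ)

theorem represents_potential (r s : ℝ → ℝ) (hr : Integrable r) (hs : MemLp s 2) :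
    Represents (potential r s hr hs) r s := by
  intro f hf hc
  rw [potential_apply, Complex.ofReal_sub, ← integral_complex_ofReal, ← integral_complex_ofReal]
  simp

theorem Represents.add {q q' : 𝓢'(ℝ, ℂ)} {r s r' s' : ℝ → ℝ} (h : Represents q r s)
    (h' : Represents q' r' s') (hr : Integrable r) (hs : MemLp s 2) (hr' : Integrable r')
    (hs' : MemLp s' 2) : Represents (q + q') (fun x => r x + r' x) (fun x => s x + s' x) := by
  intro f hf hc
  have hdc := hf.continuous_deriv (by norm_num)
  change q _ + q' _ = _
  rw [h, h', ← Complex.ofReal_add]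
  congr 1
  simp_rw [add_mul]
  rw [integral_add (integrable_mul_of_compactSupport' hr hf.continuous hc)
    (integrable_mul_of_compactSupport' hr' hf.continuous hc),
    integral_add (integrable_mul_of_compactSupport hs hdc hc.deriv)
    (integrable_mul_of_compactSupport hs' hdc hc.deriv)]
  ring

theorem Represents.smul {q : 𝓢'(ℝ, ℂ)} {r s : ℝ → ℝ} (h : Represents q r s) (c : ℝ) :
    Represents ((c : ℂ) • q) (fun x => c * r x) (fun x => c * s x) := by
  intro f hf hc
  change (c : ℂ) * q _ = _
  rw [h, ← Complex.ofReal_mul]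
  congr 1
  simp_rw [mul_assoc]
  rw [integral_const_mul, integral_const_mul]
  ring

/-! ### Supports and compactly supported potentials -/

theorem tsupport_realTest_subset (f : ℝ → ℝ) (hf : ContDiff ℝ ∞ f) (hc : HasCompactSupport f) :
    tsupport (realTest f hf hc) ⊆ tsupport f :=
  closure_mono fun x hx h0 => hx (by simp [h0])

/-- A distribution vanishes on test functions supported away from its support. -/
theorem eq_zero_of_disjoint_dsupport {q : 𝓢'(ℝ, ℂ)} (f : ℝ → ℝ) (hf : ContDiff ℝ ∞ f)
    (hc : HasCompactSupport f) (hd : Disjoint (tsupport f) (Distribution.dsupport q)) :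
    q (realTest f hf hc) = 0 := by
  -- Compactness patches the local vanishing sets together. For a union, `g` is split as `χ g + (1 -
  -- χ) g`, where `χ` is supported in `V₁` and equals `1` near the part of `tsupport g` outside
  -- `V₂`.
  have key : ∃ V : Set ℝ, IsOpen V ∧ tsupport f ⊆ V ∧
      ∀ f hf hc, tsupport f ⊆ V → q (realTest f hf hc) = 0 := by
    refine hc.isCompact.induction_on (p := fun K => ∃ V : Set ℝ, IsOpen V ∧ K ⊆ V ∧
      ∀ f hf hc, tsupport f ⊆ V → q (realTest f hf hc) = 0) ?_ ?_ ?_ ?_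
    · refine ⟨∅, isOpen_empty, le_rfl, fun g hg hgc hgs => ?_⟩
      have h0 : g = 0 := tsupport_eq_empty_iff.1 (Set.subset_empty_iff.1 hgs)
      have : realTest g hg hgc = 0 := by
        ext x
        simp [h0]
      rw [this, map_zero]
    · rintro K L hKL ⟨V, hV, hLV, h⟩
      exact ⟨V, hV, hKL.trans hLV, h⟩
    · rintro K L ⟨V₁, hV₁, hK, h₁⟩ ⟨V₂, hV₂, hL, h₂⟩
      refine ⟨V₁ ∪ V₂, hV₁.union hV₂, Set.union_subset_union hK hL, fun g hg hgc hgs => ?_⟩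
      have hscl : IsClosed (tsupport g \ V₂) := (isClosed_tsupport g).sdiff hV₂
      have hsV : tsupport g \ V₂ ⊆ V₁ := fun x hx => (hgs hx.1).resolve_right hx.2
      obtain ⟨u, hu, hsu, huV⟩ := normal_exists_closure_subset hscl hV₁ hsV
      obtain ⟨χ, hχ1, hχ0, -⟩ := exists_contMDiffMap_one_nhds_of_subset_interior
        (modelWithCornersSelf ℝ ℝ) (n := ⊤) hscl (t := closure u)
        (hsu.trans (interior_maximal subset_closure hu))
      have hχs : ContDiff ℝ ∞ χ := χ.contMDiff.contDiff
      have hχt : tsupport χ ⊆ V₁ := by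
        refine (closure_minimal (fun x hx => ?_) isClosed_closure).trans huV
        by_contra hx'
        exact hx (hχ0 x hx')
      have e1 := h₁ (fun x => χ x * g x) (hχs.mul hg) hgc.mul_left
        ((tsupport_mul_subset_left (f := χ) (g := g)).trans hχt)
      have hs' : ContDiff ℝ ∞ fun x => (1 - χ x) * g x := (contDiff_const.sub hχs).mul hg
      have hc' : HasCompactSupport fun x => (1 - χ x) * g x := hgc.mul_left
      have e2 := h₂ _ hs' hc' (by
        intro x hx
        by_contra hxV
        have hxg : x ∈ tsupport g := tsupport_mul_subset_right (f := fun x => 1 - χ x) hx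
        have hx1 := (eventually_nhdsSet_iff_forall.1 hχ1) x ⟨hxg, hxV⟩
        refine notMem_tsupport_iff_eventuallyEq.2 ?_ hx
        filter_upwards [hx1] with y hy
        simp [hy])
      have hsum : realTest g hg hgc =
          realTest (fun x => χ x * g x) (hχs.mul hg) hgc.mul_left + realTest _ hs' hc' := by
        ext x
        simp only [realTest_apply, add_apply]
        push_cast
        ring
      rw [hsum, map_add, e1, e2, add_zero]
    · intro x hx
      have hxd : x ∉ Distribution.dsupport q := fun h => Set.disjoint_left.1 hd hx h
      obtain ⟨V, hvan, hV, hxV⟩ := (Distribution.notMem_dsupport_iff x).1 hxd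
      exact ⟨V, mem_nhdsWithin_of_mem_nhds (hV.mem_nhds hxV), V, hV, le_rfl,
        fun g hg hgc hgs => hvan _ ((tsupport_realTest_subset g hg hgc).trans hgs)⟩
  obtain ⟨V, -, hV, h⟩ := key
  exact h f hf hc hV

/-- `q = s' + r` with compactly supported `s ∈ L²` and `r ∈ L¹`. -/
def IsCompactPotential (q : 𝓢'(ℝ, ℂ)) : Prop :=
  ∃ (r s : ℝ → ℝ) (R : ℝ), Integrable r ∧ MemLp s 2 ∧ (∀ x, R < |x| → r x = 0 ∧ s x = 0) ∧
    Represents q r s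

/-- With `χ = 1` near the support, `q f = q (χ f)`. Inserting `χ f` into the representation by `h₀`,
`h₁` and expanding `(χ f)'` yields `r = h₀ χ + h₁ χ'` and `s = -h₁ χ`. As `q` is real, real parts of
`h₀`, `h₁` suffice. -/
theorem isCompactPotential_of_isCompact_dsupport {q : 𝓢'(ℝ, ℂ)} (hreal : IsRealDist q)
    (hq : MemSobolev (-1) 2 q) (hcomp : IsCompact (Distribution.dsupport q)) : IsCompactPotential q := by
  obtain ⟨h₀, h₁, hrep⟩ := exists_eq_add_deriv hq
  obtain ⟨ρ, hρ0, hρ⟩ := hcomp.isBounded.subset_ball_lt 0 (0 : ℝ)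
  let χ : ContDiffBump (0 : ℝ) := ⟨ρ, ρ + 1, hρ0, by linarith⟩
  have hχs : ContDiff ℝ ∞ χ := χ.contDiff
  have hχd : Differentiable ℝ χ := hχs.differentiable (by norm_num)
  have hχ'c : Continuous (deriv χ) := hχs.continuous_deriv (by norm_num)
  obtain ⟨C, hC⟩ := (χ.hasCompactSupport.deriv).exists_bound_of_continuous hχ'c
  have hC1 : ∀ x, |χ x| ≤ 1 := fun x => by
    rw [abs_of_nonneg χ.nonneg]
    exact χ.le_one
  have m₀ : MemLp (fun x => (h₀ x).re) 2 := (Lp.memLp h₀).re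
  have m₁ : MemLp (fun x => (h₁ x).re) 2 := (Lp.memLp h₁).re
  have hχm : MemLp χ 2 := hχs.continuous.memLp_of_hasCompactSupport χ.hasCompactSupport
  have hχm' : MemLp (deriv χ) 2 := hχ'c.memLp_of_hasCompactSupport χ.hasCompactSupport.deriv
  refine ⟨fun x => (h₀ x).re * χ x + (h₁ x).re * deriv χ x, fun x => -((h₁ x).re * χ x), ρ + 1,
    (integrable_mul_of_memLp_two m₀ hχm).add (integrable_mul_of_memLp_two m₁ hχm'),
    (memLp_mul_of_abs_le m₁ hχs.continuous.aestronglyMeasurable hC1).neg, fun x hx => ?_,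
    fun f hf hc => ?_⟩
  · have hx' : x ∉ tsupport χ := by
      rw [χ.tsupport_eq, mem_closedBall_zero_iff, Real.norm_eq_abs]
      exact not_le.2 hx
    have e1 : χ x = 0 := image_eq_zero_of_notMem_tsupport hx'
    have e2 : deriv χ x = 0 :=
      image_eq_zero_of_notMem_tsupport fun h => hx' (tsupport_deriv_subset h)
    simp [e1, e2]
  · have hfd : ∀ x, HasDerivAt f (deriv f x) x := fun x =>
      (hf.differentiable (by norm_num)).differentiableAt.hasDerivAt
    have hdc := hf.continuous_deriv (by norm_num)
    have hsum : realTest f hf hc = realTest (fun x => χ x * f x) (hχs.mul hf) hc.mul_left +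
        realTest (fun x => (1 - χ x) * f x) ((contDiff_const.sub hχs).mul hf) hc.mul_left := by
      ext x
      simp only [realTest_apply, add_apply]
      push_cast
      ring
    have hzero := eq_zero_of_disjoint_dsupport (q := q) (fun x => (1 - χ x) * f x)
      ((contDiff_const.sub hχs).mul hf) hc.mul_left (by
        refine Set.disjoint_left.2 fun x hx hxd => ?_
        refine notMem_tsupport_iff_eventuallyEq.2 ?_ hx
        filter_upwards [Metric.isOpen_ball.mem_nhds (hρ hxd)] with y hy
        have : χ y = 1 := χ.one_of_mem_closedBall (Metric.ball_subset_closedBall hy)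
        simp [this])
    rw [hsum, map_add, hzero, add_zero]
    set g := realTest (fun x => χ x * f x) (hχs.mul hf) hc.mul_left with hg
    have him : (q g).im = 0 := hreal g fun x => by simp [hg]
    have hgd : ∀ x, deriv g x = ((deriv χ x * f x + χ x * deriv f x : ℝ) : ℂ) := fun x => by
      rw [hg, deriv_realTest]
      congr 1
      exact ((hχd x).hasDerivAt.mul (hfd x)).deriv
    refine Complex.ext ?_ (by rw [him, Complex.ofReal_im])
    rw [Complex.ofReal_re, hrep, Complex.add_re]
    have e0 : (∫ x, g x * h₀ x).re = ∫ x, (h₀ x).re * χ x * f x := by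
      refine (integral_re (integrable_schwartz_mul g h₀)).symm.trans ?_
      congr 1
      funext x
      change (((χ x * f x : ℝ) : ℂ) * h₀ x).re = _
      rw [Complex.re_ofReal_mul]
      ring
    have e1 : (∫ x, deriv g x * h₁ x).re =
        ∫ x, ((h₁ x).re * deriv χ x * f x + (h₁ x).re * χ x * deriv f x) := by
      refine (integral_re (integrable_deriv_schwartz_mul g h₁)).symm.trans ?_
      congr 1
      funext x
      rw [hgd]
      change (((deriv χ x * f x + χ x * deriv f x : ℝ) : ℂ) * h₁ x).re = _
      rw [Complex.re_ofReal_mul]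
      ring
    have i0 : Integrable fun x => (h₀ x).re * χ x * f x :=
      integrable_mul_of_compactSupport' (integrable_mul_of_memLp_two m₀ hχm) hf.continuous hc
    have i1 : Integrable fun x => (h₁ x).re * deriv χ x * f x :=
      integrable_mul_of_compactSupport' (integrable_mul_of_memLp_two m₁ hχm') hf.continuous hc
    have i2 : Integrable fun x => (h₁ x).re * χ x * deriv f x :=
      integrable_mul_of_compactSupport' (integrable_mul_of_memLp_two m₁ hχm) hdc hc.deriv
    rw [e0, e1, integral_add i1 i2]
    simp_rw [add_mul, neg_mul]
    rw [integral_add i0 i1, integral_neg]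
    ring

theorem IsCompactPotential.add {q q' : 𝓢'(ℝ, ℂ)} (h : IsCompactPotential q)
    (h' : IsCompactPotential q') : IsCompactPotential (q + q') := by
  obtain ⟨r, s, R, hr, hs, hR, hrep⟩ := h
  obtain ⟨r', s', R', hr', hs', hR', hrep'⟩ := h'
  refine ⟨_, _, max R R', hr.add hr', hs.add hs', fun x hx => ?_, hrep.add hrep' hr hs hr' hs'⟩
  obtain ⟨e1, e2⟩ := hR x ((le_max_left _ _).trans_lt hx)
  obtain ⟨e3, e4⟩ := hR' x ((le_max_right _ _).trans_lt hx)
  simp [e1, e2, e3, e4]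

theorem IsCompactPotential.smul {q : 𝓢'(ℝ, ℂ)} (h : IsCompactPotential q) (c : ℝ) :
    IsCompactPotential ((c : ℂ) • q) := by
  obtain ⟨r, s, R, hr, hs, hR, hrep⟩ := h
  refine ⟨_, _, R, hr.const_mul c, hs.const_mul c, fun x hx => ?_, hrep.smul c⟩
  obtain ⟨e1, e2⟩ := hR x hx
  simp [e1, e2]

theorem isCompactPotential_zero : IsCompactPotential 0 :=
  ⟨0, 0, 0, integrable_zero _ _ _, MemLp.zero, fun x _ => ⟨rfl, rfl⟩, fun f hf hc => by
    change (0 : ℂ) = _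
    simp⟩

/-- `δ_a = s' + r` with `r` the indicator function of `(a, a + 1]` and `s = (a + 1 - x) r`. -/
theorem delta_eq_potential (a : ℝ) : ∃ (r s : ℝ → ℝ) (hr : Integrable r) (hs : MemLp s 2),
    (∀ x, |a| + 1 < |x| → r x = 0 ∧ s x = 0) ∧ delta a = potential r s hr hs := by
  have hr : Integrable ((Set.Ioc a (a + 1)).indicator fun _ => (1 : ℝ)) :=
    (integrable_indicator_iff measurableSet_Ioc).2 (by simp)
  have hs : MemLp ((Set.Ioc a (a + 1)).indicator fun x => a + 1 - x) 2 :=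
    memLp_indicator_Ioc (by fun_prop) _ _
  refine ⟨_, _, hr, hs, fun x hx => ?_, ?_⟩
  · have : x ∉ Set.Ioc a (a + 1) := fun h => by
      refine hx.not_ge (abs_le.2 ⟨?_, ?_⟩)
      · linarith [h.1, neg_abs_le a]
      · linarith [h.2, le_abs_self a]
    simp [this]
  · ext f
    rw [delta_apply, potential_apply]
    have e1 : ∫ x, (((Set.Ioc a (a + 1)).indicator (fun _ => (1 : ℝ)) x : ℝ) : ℂ) * f x =
        ∫ x in a..(a + 1), f x := by
      rw [intervalIntegral.integral_of_le (by linarith), ← integral_indicator measurableSet_Ioc]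
      congr 1
      funext x
      by_cases hx : x ∈ Set.Ioc a (a + 1) <;> simp [hx]
    have e2 : ∫ x, (((Set.Ioc a (a + 1)).indicator (fun x => a + 1 - x) x : ℝ) : ℂ) * deriv f x =
        ∫ x in a..(a + 1), (((a + 1 - x : ℝ)) : ℂ) * deriv f x := by
      rw [intervalIntegral.integral_of_le (by linarith), ← integral_indicator measurableSet_Ioc]
      congr 1
      funext x
      by_cases hx : x ∈ Set.Ioc a (a + 1)
      · rw [Set.indicator_of_mem hx, Set.indicator_of_mem hx]
      · rw [Set.indicator_of_notMem hx, Set.indicator_of_notMem hx]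
        simp
    have hd : ∀ x : ℝ, HasDerivAt (fun x : ℝ => (((a + 1 - x : ℝ)) : ℂ)) (-1) x := fun x => by
      simpa using ((hasDerivAt_id x).const_sub (a + 1)).ofReal_comp
    have hdf : Continuous (deriv f) := (SchwartzMap.derivCLM ℂ ℂ f).continuous
    -- The weight `a + 1 - x` equals `1` at `a` and `0` at `a + 1`, so the boundary term is exactly
    -- `-f(a)`.
    have hparts := intervalIntegral.integral_mul_deriv_eq_deriv_mul (a := a) (b := a + 1)
      (fun x _ => hd x) (fun x _ => f.hasDerivAt x) (by simp)
      (hdf.intervalIntegrable _ _)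
    rw [e1, e2, hparts]
    simp

theorem isCompactPotential_delta (a : ℝ) : IsCompactPotential (delta a) := by
  obtain ⟨r, s, hr, hs, hR, h⟩ := delta_eq_potential a
  exact ⟨r, s, _, hr, hs, hR, h ▸ represents_potential r s hr hs⟩

theorem memSobolev_delta (a : ℝ) : MemSobolev (-1) 2 (delta a) := by
  obtain ⟨r, s, hr, hs, hR, h⟩ := delta_eq_potential a
  exact h ▸ memSobolev_potential r s hr hs

theorem isRealDist_delta (a : ℝ) : IsRealDist (delta a) := fun f hf => by
  rw [delta_apply]
  exact hf a

theorem isCompactPotential_miura_cutLog {ϕ : ℝ → ℝ} (hϕ : ContDiff ℝ ∞ ϕ)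
    (hc : HasCompactSupport ϕ) (a : ℝ) :
    IsCompactPotential (miura (cutLog ϕ a) (memLp_cutLog hϕ hc a)) := by
  obtain ⟨ρ, hρ⟩ := hc.isCompact.isBounded.subset_closedBall 0
  refine ⟨_, _, ρ + |a|, (memLp_cutLog hϕ hc a).integrable_sq, memLp_cutLog hϕ hc a,
    fun x hx => ?_, miura_eq_potential _ (memLp_cutLog hϕ hc a) ▸ represents_potential _ _ _ _⟩
  have : ϕ (x - a) = 0 := by
    refine image_eq_zero_of_notMem_tsupport fun h => ?_
    have := hρ h
    rw [mem_closedBall_zero_iff, Real.norm_eq_abs] at this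
    linarith [abs_sub_abs_le_abs_sub x a]
  simp [cutLog, this]

/-! ### The Schrödinger form -/

theorem hasCompactSupport_norm_sq {φ : ℝ → ℂ} (hc : HasCompactSupport φ) :
    HasCompactSupport fun x => ‖φ x‖ ^ 2 :=
  hc.comp_left (g := fun z : ℂ => ‖z‖ ^ 2) (by simp)

theorem normSq_eq_realTest (φ : ℝ → ℂ) (hφ : ContDiff ℝ ∞ φ) (hc : HasCompactSupport φ) :
    normSq φ hφ hc = realTest (fun x => ‖φ x‖ ^ 2) (hφ.norm_sq ℝ)
      (hasCompactSupport_norm_sq hc) := rfl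

theorem Represents.schrodingerForm_eq {q : 𝓢'(ℝ, ℂ)} {r s : ℝ → ℝ} (h : Represents q r s)
    (φ : ℝ → ℂ) (hφ : ContDiff ℝ ∞ φ) (hc : HasCompactSupport φ) :
    schrodingerForm q φ hφ hc = (∫ x, ‖deriv φ x‖ ^ 2) +
      ((∫ x, r x * ‖φ x‖ ^ 2) - ∫ x, s x * (2 * inner ℝ (φ x) (deriv φ x))) := by
  have hd : ∀ x, deriv (fun x => ‖φ x‖ ^ 2) x = 2 * inner ℝ (φ x) (deriv φ x) := fun x =>
    ((hφ.differentiable (by norm_num)).differentiableAt.hasDerivAt.norm_sq).deriv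
  rw [schrodingerForm, normSq_eq_realTest, h, Complex.ofReal_re]
  simp_rw [hd]

theorem Represents.formNonneg {q : 𝓢'(ℝ, ℂ)} {r s : ℝ → ℝ} (h : Represents q r s)
    (hq : SchrodingerNonneg q) : FormNonneg r s := by
  intro φ hφ hc
  have hφ' : ContDiff ℝ ∞ fun x => (φ x : ℂ) := Complex.ofRealCLM.contDiff.comp hφ
  have hc' : HasCompactSupport fun x => (φ x : ℂ) :=
    hc.comp_left (g := fun t : ℝ => (t : ℂ)) (by simp)
  have hd : ∀ x, deriv (fun x => (φ x : ℂ)) x = ((deriv φ x : ℝ) : ℂ) := deriv_realTest φ hφ hc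
  have := hq _ hφ' hc'
  rw [h.schrodingerForm_eq] at this
  simp only [hd, Complex.norm_real, Real.norm_eq_abs, sq_abs, Complex.inner, Complex.conj_ofReal,
    ← Complex.ofReal_mul, Complex.ofReal_re] at this
  simp only [mul_assoc, mul_comm (φ _)] at this ⊢
  linarith

/-- The form of `-d²/dx² + u' + u²` is `∫ |φ' - u φ|²`. -/
theorem schrodingerNonneg_miura (u : ℝ → ℝ) (hu : MemLp u 2) :
    SchrodingerNonneg (miura u hu) := by
  intro φ hφ hc
  have hrep : Represents (miura u hu) (fun x => u x ^ 2) u :=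
    miura_eq_potential u hu ▸ represents_potential _ _ _ _
  rw [hrep.schrodingerForm_eq]
  have hdc : Continuous (deriv φ) := hφ.continuous_deriv (by norm_num)
  have i0 : Integrable fun x => ‖deriv φ x‖ ^ 2 :=
    (hdc.norm.pow 2).integrable_of_hasCompactSupport (hasCompactSupport_norm_sq hc.deriv)
  have i1 : Integrable fun x => u x ^ 2 * ‖φ x‖ ^ 2 :=
    integrable_mul_of_compactSupport' hu.integrable_sq (hφ.continuous.norm.pow 2)
      (hasCompactSupport_norm_sq hc)
  have i2 : Integrable fun x => u x * (2 * inner ℝ (φ x) (deriv φ x)) := by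
    refine integrable_mul_of_compactSupport hu
      (continuous_const.mul (hφ.continuous.inner hdc)) (hc.mono fun x hx h0 => hx ?_)
    simp [h0]
  rw [← integral_sub i1 i2]
  refine le_of_le_of_eq ?_ (integral_add i0 (i1.sub i2))
  refine integral_nonneg fun x => ?_
  have := norm_sub_sq_real (deriv φ x) (u x • φ x)
  rw [norm_smul, inner_smul_right, real_inner_comm, mul_pow, Real.norm_eq_abs, sq_abs] at this
  change 0 ≤ ‖deriv φ x‖ ^ 2 + (u x ^ 2 * ‖φ x‖ ^ 2 - u x * (2 * inner ℝ (φ x) (deriv φ x)))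
  linarith [sq_nonneg ‖deriv φ x - u x • φ x‖]

/-! ### Admissible perturbations and assembly -/

theorem IsRealDist.add {q q' : 𝓢'(ℝ, ℂ)} (h : IsRealDist q) (h' : IsRealDist q') :
    IsRealDist (q + q') := fun f hf => by
  change (q f + q' f).im = 0
  rw [Complex.add_im, h f hf, h' f hf, add_zero]

theorem IsRealDist.smul {q : 𝓢'(ℝ, ℂ)} (h : IsRealDist q) (c : ℝ) :
    IsRealDist ((c : ℂ) • q) := fun f hf => by
  change ((c : ℂ) * q f).im = 0
  rw [Complex.im_ofReal_mul, h f hf, mul_zero]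

theorem eq_miura_of_riccatiEq {q : 𝓢'(ℝ, ℂ)} {r s u : ℝ → ℝ} (hq : MemSobolev (-1) 2 q)
    (h : Represents q r s) (hu : MemLp u 2) (hR : RiccatiEq u r s) : q = miura u hu := by
  rw [miura_eq_potential]
  refine ext_of_memSobolev hq (memSobolev_potential _ _ _ _) fun f hf hc => ?_
  rw [h, represents_potential, hR f hf hc]

/-- A real distribution of `H⁻¹(ℝ)` of the form `s' + r` with compactly supported `s ∈ L²` and
`r ∈ L¹`. -/
structure IsPerturbation (q : 𝓢'(ℝ, ℂ)) : Prop where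
  isRealDist : IsRealDist q
  memSobolev : MemSobolev (-1) 2 q
  isCompactPotential : IsCompactPotential q

theorem IsPerturbation.add {q q' : 𝓢'(ℝ, ℂ)} (h : IsPerturbation q) (h' : IsPerturbation q') :
    IsPerturbation (q + q') :=
  ⟨h.1.add h'.1, h.2.add h'.2, h.3.add h'.3⟩

theorem IsPerturbation.smul {q : 𝓢'(ℝ, ℂ)} (h : IsPerturbation q) (c : ℝ) :
    IsPerturbation ((c : ℂ) • q) :=
  ⟨h.1.smul c, h.2.smul _, h.3.smul c⟩

theorem isPerturbation_zero : IsPerturbation 0 :=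
  ⟨fun _ _ => rfl, by simp, isCompactPotential_zero⟩

theorem isPerturbation_sum {ι : Type*} (t : Finset ι) (c : ι → ℝ) {q : ι → 𝓢'(ℝ, ℂ)}
    (h : ∀ i, IsPerturbation (q i)) : IsPerturbation (∑ i ∈ t, (c i : ℂ) • q i) :=
  Finset.sum_induction _ IsPerturbation (fun _ _ => IsPerturbation.add) isPerturbation_zero
    fun i _ => (h i).smul (c i)

theorem isPerturbation_delta (a : ℝ) : IsPerturbation (delta a) :=
  ⟨isRealDist_delta a, memSobolev_delta a, isCompactPotential_delta a⟩

theorem isPerturbation_miura_cutLog {ϕ : ℝ → ℝ} (hϕ : ContDiff ℝ ∞ ϕ)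
    (hc : HasCompactSupport ϕ) (a : ℝ) :
    IsPerturbation (miura (cutLog ϕ a) (memLp_cutLog hϕ hc a)) :=
  ⟨miura_eq_potential _ (memLp_cutLog hϕ hc a) ▸ isRealDist_potential _ _ _ _,
    miura_eq_potential _ (memLp_cutLog hϕ hc a) ▸ memSobolev_potential _ _ _ _,
    isCompactPotential_miura_cutLog hϕ hc a⟩

theorem SchrodingerNonneg.add_delta {q : 𝓢'(ℝ, ℂ)} (h : SchrodingerNonneg q) {ι : Type*}
    (t : Finset ι) (x α : ι → ℝ) (hα : ∀ i, 0 ≤ α i) :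
    SchrodingerNonneg (q + ∑ i ∈ t, (α i : ℂ) • delta (x i)) := by
  induction t using Finset.cons_induction with
  | empty => simpa using h
  | cons i t hi ih =>
    intro φ hφ hc
    rw [Finset.sum_cons, add_left_comm]
    refine (add_nonneg (mul_nonneg (hα i) (sq_nonneg ‖φ (x i)‖)) (ih φ hφ hc)).trans_eq ?_
    have e : ((α i : ℂ) • delta (x i) : 𝓢'(ℝ, ℂ)) (normSq φ hφ hc) =
        ((α i * ‖φ (x i)‖ ^ 2 : ℝ) : ℂ) := by
      change (α i : ℂ) * delta (x i) (normSq φ hφ hc) = _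
      rw [delta_apply, normSq_eq_realTest, realTest_apply, Complex.ofReal_mul]
    have e' : ∀ p p' : 𝓢'(ℝ, ℂ), ((p + p') (normSq φ hφ hc)).re =
        (p (normSq φ hφ hc)).re + (p' (normSq φ hφ hc)).re := fun p p' => Complex.add_re _ _
    rw [schrodingerForm, schrodingerForm, e' (_ • _), e, Complex.ofReal_re]
    ring

/-- The common core of the three statements. The two representatives of `q₀` are treated separately:
`u` gives the one integrable at `+∞`, `v` the one at `-∞`. Outside the support of the perturbation
`r` and `s` vanish, so the potential there is still exactly of Miura form. -/
theorem add_mem_classQ {q₀ q₁ : 𝓢'(ℝ, ℂ)} (hq₀ : q₀ ∈ classQ) (hq₁ : IsPerturbation q₁)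
    (hpos : SchrodingerNonneg (q₀ + q₁)) : q₀ + q₁ ∈ classQ := by
  obtain ⟨hreal, hsob, ⟨u, hu, hui, hqu⟩, ⟨v, hv, hvi, hqv⟩⟩ := hq₀
  obtain ⟨hreal₁, hsob₁, r, s, R, hr, hs, hR, hrep⟩ := hq₁
  have hsob' := hsob.add hsob₁
  have hsi : Integrable s := by
    have hind : (Set.Icc (-R) R).indicator s = s := by
      refine Set.indicator_eq_self.2 fun x hx => ?_
      by_contra hx'
      exact hx (hR x (not_le.1 fun h => hx' (abs_le.1 h))).2
    rw [← hind, integrable_indicator_iff measurableSet_Icc]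
    exact (hs.mono_measure Measure.restrict_le_self).integrable (by norm_num)
  have hrep' : ∀ w (hw : MemLp w 2), q₀ = miura w hw →
      Represents (q₀ + q₁) (fun x => w x ^ 2 + r x) (fun x => w x + s x) := fun w hw h => by
    have h' : Represents q₀ (fun x => w x ^ 2) w :=
      h ▸ miura_eq_potential w hw ▸ represents_potential _ _ _ _
    exact h'.add hrep hw.integrable_sq hw hr hs
  have hout : ∀ (w : ℝ → ℝ) (x : ℝ), max R 0 < |x| → w x ^ 2 + r x = (w x + s x) ^ 2 := fun w x hx => by
    obtain ⟨e1, e2⟩ := hR x ((le_max_left _ _).trans_lt hx)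
    rw [e1, e2, add_zero, add_zero]
  refine ⟨hreal.add hreal₁, hsob', ?_, ?_⟩
  · obtain ⟨p, hp, hpi, hpR⟩ := exists_riccatiEq (hu.integrable_sq.add hr) (hu.add hs)
      (le_max_right R 0) (fun x hx => hout u x (hx.trans_le (le_abs_self x)))
      (hui.add hsi.integrableOn) ((hrep' u hu hqu).formNonneg hpos)
    exact ⟨p, hp, hpi, eq_miura_of_riccatiEq hsob' (hrep' u hu hqu) hp hpR⟩
  · obtain ⟨p, hp, hpi, hpR⟩ := exists_riccatiEq_left (hv.integrable_sq.add hr) (hv.add hs)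
      (le_max_right R 0) (fun x hx => hout v x (by linarith [neg_le_abs x]))
      (hvi.add hsi.integrableOn) ((hrep' v hv hqv).formNonneg hpos)
    exact ⟨p, hp, hpi, eq_miura_of_riccatiEq hsob' (hrep' v hv hqv) hp hpR⟩

end Miura

end

theorem proposition2p11 (q₀ : 𝓢'(ℝ, ℂ)) (hq₀ : q₀ ∈ Miura.classQ) :
    -- compactly supported perturbations that keep the operator nonnegative
    (∀ q₁ : 𝓢'(ℝ, ℂ), Miura.IsRealDist q₁ → MemSobolev (-1) 2 q₁ →
      IsCompact (Distribution.dsupport q₁) →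
      Miura.SchrodingerNonneg (q₀ + q₁) → q₀ + q₁ ∈ Miura.classQ) ∧
    -- finitely many nonnegative delta functions
    (∀ (n : ℕ) (x α : Fin n → ℝ), (∀ j, 0 ≤ α j) →
      q₀ + ∑ j, (α j : ℂ) • delta (x j) ∈ Miura.classQ) ∧
    -- finitely many delta functions and Coulomb-type singularities
    (∀ (n : ℕ) (x α β : Fin n → ℝ) (ϕ : ℝ → ℝ) (hϕ : ContDiff ℝ ∞ ϕ) (hc : HasCompactSupport ϕ),
      (∀ j, 0 ≤ α j) → (∀ j, 0 ≤ β j) →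
      Miura.SchrodingerNonneg (q₀ + ∑ j, (α j : ℂ) • delta (x j) +
        ∑ j, (β j : ℂ) • Miura.miura (Miura.cutLog ϕ (x j)) (Miura.memLp_cutLog hϕ hc (x j))) →
      q₀ + ∑ j, (α j : ℂ) • delta (x j) +
        ∑ j, (β j : ℂ) • Miura.miura (Miura.cutLog ϕ (x j)) (Miura.memLp_cutLog hϕ hc (x j))
        ∈ Miura.classQ) := by
  have hδ : ∀ (n : ℕ) (x α : Fin n → ℝ),
      Miura.IsPerturbation (∑ j, (α j : ℂ) • delta (x j)) := fun n x α =>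
    Miura.isPerturbation_sum _ α fun j => Miura.isPerturbation_delta (x j)
  refine ⟨fun q₁ hreal hsob hcomp hpos => ?_, fun n x α hα => ?_,
    fun n x α β ϕ hϕ hc hα hβ hpos => ?_⟩
  · exact Miura.add_mem_classQ hq₀
      ⟨hreal, hsob, Miura.isCompactPotential_of_isCompact_dsupport hreal hsob hcomp⟩ hpos
  -- Nonnegativity is automatic here: the form of a Miura potential is a square, and each delta
  -- function adds `α |φ(x)|² ≥ 0`.
  · obtain ⟨u, hu, -, rfl⟩ := hq₀.2.2.1
    exact Miura.add_mem_classQ hq₀ (hδ n x α)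
      ((Miura.schrodingerNonneg_miura u hu).add_delta _ x α hα)
  · rw [add_assoc] at hpos ⊢
    exact Miura.add_mem_classQ hq₀ ((hδ n x α).add (Miura.isPerturbation_sum _ β fun j =>
      Miura.isPerturbation_miura_cutLog hϕ hc (x j))) hpos
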